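/- **Theorem (Smooth Afriat–Varian theorem).** Let $n\ge 1$, $k\ge 1$ and $T\ge 0$ be integers, write $xy=\sum_i x_iy_i$, and let $\mathbf R^n_+=\{x: x_i\ge 0\ \forall i\}$, $\mathbf R^n_{++}=\{x: x_i>0\ \forall i\}$. Let $\mathcal F$ be the set of functions $f:\mathbf R^n_+\to\mathbf R_+$ that are concave and satisfy $f(\lambda x)=\lambda f(x)$ for all $\lambda\ge 0$, $x\in\mathbf R^n_+$. The gauge transform of $f\in\mathcal F$, $f\not\equiv 0$, is $f^*(p)=\inf\{\,qp/f(q) : q\in\mathbf R^n_+,\ f(q)>0\,\}$, $p\in \mathbf R^n_+$. Let $\mathcal F_k$ be the set of all $f\in\mathcal F$, $f\not\equiv0$, such that both $f$ and $f^*$ are continuous on $\mathbf R^n_+$ and of class $C^k$ on $\mathbf R^n_{++}$. Let $p^t,q^t\in\mathbf R^n_+\setminus\{0\}$, $t=1,\dots,T$, be market data (prices and quantities) such that there are no $t\neq\tau$ for which both $p^t$ is proportional to $p^\tau$ and $q^t$ is proportional to $q^\tau$. Assume moreover that at least one of the following holds (this is so, in particular, if all $p^t$ and $q^t$ are in $\mathbf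 R^n_{++}$): * all $p^t\in\mathbf R^n_{++}$, and every $q^t$ that is proportional to some $q^\tau$ with $\tau\ne t$ is in $\mathbf R^n_{++}$; * all $q^t\in\mathbf R^n_{++}$, and every $p^t$ that is proportional to some $p^\tau$ with $\tau\ne t$ is in $\mathbf R^n_{++}$. Then the following statements are equivalent. 1. There is $Q\in\mathcal F_k$ such that $q^t\in\operatorname{Argmax}\{Q(q): p^tq\le p^tq^t,\ q\ge 0\}$ for all $t$. 2. For every ordered tuple $(t(1),\dots,t(m))$ of $m\ge2$ pairwise distinct indices from $\{1,\dots,T\}$, $$(p^{t(1)}q^{t(2)})(p^{t(2)}q^{t(3)})\cdots(p^{t(m)}q^{t(1)})>(p^{t(1)}q^{t(1)})(p^{t(2)}q^{t(2)})\cdots(p^{t(m)}q^{t(m)}).$$ 3. There are $\lambda_1,\dots,\lambda_T>0$ with $\lambda_t(p^tq^t)<\lambda_\tau(p^\tau q^t)$ for all $t\ne\tau$. 4. There is $P\in\mathcal F_k$ such that $p^t\in\operatorname{Argmax}\{P(p): q^tp\le q^tp^t,\ p\ge 0\}$ for all $t$. 5. There are $\mu_1,\dots,\mu_T>0$ with $\mu_t(p^tq^t)<\mu_\tau(p^tq^\tau)$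 for all $t\neq\tau$. -/

import Mathlib

open scoped Matrix

/-- The closed nonnegative orthant of `ℝⁿ`. -/
def nonnegOrthant (n : ℕ) : Set (Fin n → ℝ) := {x | ∀ i, 0 ≤ x i}

/-- The open positive orthant of `ℝⁿ`, the interior of the nonnegative orthant. -/
def posOrthant (n : ℕ) : Set (Fin n → ℝ) := {x | ∀ i, 0 < x i}

/-- The class `𝓕` of nonnegative, positively homogeneous, concave functions on the
nonnegative orthant (values outside of the orthant are irrelevant). -/
structure IsUtility {n : ℕ} (f : (Fin n → ℝ) → ℝ) : Prop where
  nonneg : ∀ x ∈ nonnegOrthant n, 0 ≤ f x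
  homogeneous : ∀ c : ℝ, 0 ≤ c → ∀ x ∈ nonnegOrthant n, f (c • x) = c * f x
  concave : ConcaveOn ℝ (nonnegOrthant n) f

/-- The gauge transform `p ↦ inf_{q ≥ 0} (q p) / f q`, where a quotient with `f q = 0` is read
as `+∞`, so that it does not contribute to the infimum. -/
noncomputable def gaugeTransform {n : ℕ} (f : (Fin n → ℝ) → ℝ) (p : Fin n → ℝ) : ℝ :=
  sInf ((fun q => (q ⬝ᵥ p) / f q) '' {q | q ∈ nonnegOrthant n ∧ 0 < f q})

/-- `k`-smoothness of a function on the orthant: continuous on the closed orthant and of class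
`C^k` in its interior. (A homogeneous function that is differentiable at the origin is linear.) -/
def IsSmoothOnOrthant {n : ℕ} (k : ℕ) (f : (Fin n → ℝ) → ℝ) : Prop :=
  ContinuousOn f (nonnegOrthant n) ∧ ContDiffOn ℝ k f (posOrthant n)

/-- The class `𝓕_k`: functions of `𝓕`, not identically zero (so that the dual gauge exists),
that are `k`-smooth together with their gauge transform. -/
structure IsSmoothUtility {n : ℕ} (k : ℕ) (f : (Fin n → ℝ) → ℝ) : Prop where
  isUtility : IsUtility f
  nontrivial : ∃ x ∈ nonnegOrthant n, f x ≠ 0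
  smooth : IsSmoothOnOrthant k f
  smooth_gauge : IsSmoothOnOrthant k (gaugeTransform f)

/-- `x` maximizes `f` over the budget set `{y ≥ 0 | a y ≤ a x}`. -/
def IsBudgetArgmax {n : ℕ} (f : (Fin n → ℝ) → ℝ) (a x : Fin n → ℝ) : Prop :=
  x ∈ nonnegOrthant n ∧ ∀ y ∈ nonnegOrthant n, a ⬝ᵥ y ≤ a ⬝ᵥ x → f y ≤ f x

/-- The strict homogeneous strong axiom of revealed preference: the strict cyclical inequality for
every ordered tuple of at least two pairwise distinct observations. In `Fin (m + 2)` the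
successor `i + 1` of the last index is the first one. -/
def StrictHomogeneousStrongAxiom {n T : ℕ} (p q : Fin T → Fin n → ℝ) : Prop :=
  ∀ (m : ℕ) (t : Fin (m + 2) → Fin T), Function.Injective t →
    ∏ i, (p (t i) ⬝ᵥ q (t i)) < ∏ i, (p (t i) ⬝ᵥ q (t (i + 1)))

/-!
# Smooth rationalization of market data

Suppose a smooth homogeneous utility `Q` rationalizes the data. With `l t = Q (q t) / (p t q t)` the
linear function `l t * p t` majorizes `Q` and touches it at `q t`, so `l t * (p t q t) = Q (q t)` is
at most `l τ * (p τ q t)`. If equality holds, both `l t * p t` and `l τ * p τ` touch `Q` at `q t`,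
and both `q t` and `q τ` minimize the cost-to-utility ratio at the prices `p τ`; differentiability
of `Q` and of its gauge transform at interior points then makes prices and quantities proportional,
which the data exclude (`exists_strict_multipliers_of_smooth_rationalization`). The existence of
strict multipliers is the existence of a potential for the weights `log (p τ q t) - log (p t q t)`,
hence amounts to positivity of all simple cycles (`exists_strict_potential_of_cycle_pos`), and the
two systems of multipliers are reciprocal to each other (`exists_dual_multipliers`).

For the converse let all prices be interior; the other case follows by exchanging prices and
quantities. Given the multipliers `μ`, the linear functions `r t = μ t * q t` satisfy
`r t (p t) < r τ (p t)`, so the minimum of the `r t` is a gauge of prices that has `r t` as its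
differential at `p t`. It has to be made smooth and, at the same time, as strictly concave as
smoothness of its gauge transform requires, without losing exactness at the points `p t`, where the
differential may lie on the boundary of the orthant. To this end

* each `r t` is replaced by a mixture of itself with the Cobb–Douglas function that touches it at
  `p t`; this depends on the same coordinates as `r t` and, modulo homogeneity, is strictly concave
  in them;
* the minimum is replaced by iterated smooth minima of two functions, which are exact where the two
  values are not close to each other.

The property that survives these operations is `IsStrictSmoothGauge`: the second derivative vanishes
only in directions that are radial on the coordinates of nonzero marginal utility. A multiple
of the symmetric Cobb–Douglas function is added to the family, so that the result `P` vanishes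
on the boundary. Then every interior quantity vector is a logarithmic gradient of `P`, the Hessian
of `log P` is nondegenerate there, and the inverse function theorem exhibits the gauge transform of
`P` locally as `1 / P` composed with a smooth inverse of the logarithmic gradient
(`IsStrictSmoothGauge.contDiffOn_gaugeTransform`). By biduality
(`IsStrictSmoothGauge.gaugeTransform_gaugeTransform`) both `P` and its gauge transform are smooth
utilities; the former rationalizes the data with exchanged roles and the latter the data themselves.
-/

section

open Filter Topology Set
open scoped ContDiff

/-! ### Orthants and utilities -/

section Basic

variable {n : ℕ} {f : (Fin n → ℝ) → ℝ} {x y : Fin n → ℝ}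

theorem posOrthant_subset_nonnegOrthant : posOrthant n ⊆ nonnegOrthant n :=
  fun _ hx i => (hx i).le

theorem isOpen_posOrthant : IsOpen (posOrthant n) := by
  simp only [posOrthant, ofPred_forall]
  exact isOpen_iInter_of_finite fun i => isOpen_lt continuous_const (continuous_apply i)

theorem isClosed_nonnegOrthant : IsClosed (nonnegOrthant n) := by
  simp only [nonnegOrthant, ofPred_forall]
  exact isClosed_iInter fun i => isClosed_le continuous_const (continuous_apply i)

theorem posOrthant_mem_nhds (hx : x ∈ posOrthant n) : posOrthant n ∈ 𝓝 x :=
  isOpen_posOrthant.mem_nhds hx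

theorem add_mem_nonnegOrthant (hx : x ∈ nonnegOrthant n) (hy : y ∈ nonnegOrthant n) :
    x + y ∈ nonnegOrthant n := fun i => add_nonneg (hx i) (hy i)

theorem smul_mem_nonnegOrthant {c : ℝ} (hc : 0 ≤ c) (hx : x ∈ nonnegOrthant n) :
    c • x ∈ nonnegOrthant n := fun i => mul_nonneg hc (hx i)

theorem convex_nonnegOrthant : Convex ℝ (nonnegOrthant n) :=
  fun _ hx _ hy _ _ ha hb _ =>
    add_mem_nonnegOrthant (smul_mem_nonnegOrthant ha hx) (smul_mem_nonnegOrthant hb hy)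

theorem dotProduct_nonneg_of_mem (hx : x ∈ nonnegOrthant n) (hy : y ∈ nonnegOrthant n) :
    0 ≤ x ⬝ᵥ y := Finset.sum_nonneg fun i _ => mul_nonneg (hx i) (hy i)

theorem dotProduct_pos_of_mem (hx : x ∈ posOrthant n) (hy : y ∈ nonnegOrthant n) (hy0 : y ≠ 0) :
    0 < x ⬝ᵥ y := by
  obtain ⟨i, hi⟩ := Function.ne_iff.1 hy0
  exact Finset.sum_pos' (fun i _ => mul_nonneg (hx i).le (hy i))
    ⟨i, Finset.mem_univ i, mul_pos (hx i) (lt_of_le_of_ne (hy i) (Ne.symm hi))⟩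

theorem continuous_dotProduct_left (a : Fin n → ℝ) :
    Continuous fun x : Fin n → ℝ => a ⬝ᵥ x := by
  unfold dotProduct; fun_prop

/-- Concavity of a positively homogeneous function amounts to superadditivity. -/
theorem IsUtility.add_le (hf : IsUtility f) (hx : x ∈ nonnegOrthant n)
    (hy : y ∈ nonnegOrthant n) : f x + f y ≤ f (x + y) := by
  have h := hf.concave.2 hx hy (show (0 : ℝ) ≤ 1 / 2 by norm_num)
    (show (0 : ℝ) ≤ 1 / 2 by norm_num) (by norm_num)
  rw [show (1 / 2 : ℝ) • x + (1 / 2 : ℝ) • y = (1 / 2 : ℝ) • (x + y) from (smul_add _ _ _).symm,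
    hf.homogeneous _ (by norm_num) _ (add_mem_nonnegOrthant hx hy)] at h
  simp only [smul_eq_mul] at h
  linarith

theorem isUtility_of_add_le (h0 : ∀ x ∈ nonnegOrthant n, 0 ≤ f x)
    (hh : ∀ c : ℝ, 0 ≤ c → ∀ x ∈ nonnegOrthant n, f (c • x) = c * f x)
    (ha : ∀ x ∈ nonnegOrthant n, ∀ y ∈ nonnegOrthant n, f x + f y ≤ f (x + y)) :
    IsUtility f := by
  refine ⟨h0, hh, convex_nonnegOrthant, fun x hx y hy a b ha' hb' _ => ?_⟩
  have h := ha _ (smul_mem_nonnegOrthant ha' hx) _ (smul_mem_nonnegOrthant hb' hy)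
  rwa [hh a ha' x hx, hh b hb' y hy] at h

theorem IsUtility.mono (hf : IsUtility f) (hx : x ∈ nonnegOrthant n) (hxy : ∀ i, x i ≤ y i) :
    f x ≤ f y := by
  have hd : y - x ∈ nonnegOrthant n := fun i => sub_nonneg.2 (hxy i)
  have h := hf.add_le hx hd
  have h0 := hf.nonneg _ hd
  rw [add_sub_cancel] at h
  linarith

theorem IsUtility.map_zero (hf : IsUtility f) : f 0 = 0 := by
  have h := hf.homogeneous 0 le_rfl 0 (fun _ => le_rfl)
  simpa using h

theorem IsUtility.pos_of_mem_posOrthant (hf : IsUtility f) (hx : x ∈ nonnegOrthant n)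
    (hfx : 0 < f x) (hy : y ∈ posOrthant n) : 0 < f y := by
  obtain ⟨c, hc, hcx⟩ : ∃ c : ℝ, 0 < c ∧ ∀ i, c * x i ≤ y i := by
    have h : ∀ᶠ c : ℝ in 𝓝[>] 0, ∀ i, c * x i ≤ y i := by
      refine eventually_all.2 fun i => ?_
      have ht : Tendsto (fun c : ℝ => c * x i) (𝓝[>] 0) (𝓝 (0 * x i)) :=
        ((continuous_id.mul continuous_const).tendsto 0).mono_left nhdsWithin_le_nhds
      rw [zero_mul] at ht
      exact (ht.eventually (gt_mem_nhds (hy i))).mono fun _ h => h.le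
    obtain ⟨c, h, hc⟩ := (h.and self_mem_nhdsWithin).exists
    exact ⟨c, hc, h⟩
  have h := hf.mono (smul_mem_nonnegOrthant hc.le hx) (y := y) hcx
  rw [hf.homogeneous c hc.le x hx] at h
  exact lt_of_lt_of_le (mul_pos hc hfx) h

/-- A monotone positively homogeneous function is lower semicontinuous on the closed orthant, since
the points of the orthant near `x` dominate `c • x` for every `c < 1`. -/
theorem IsUtility.eventually_lt (hf : IsUtility f) (hx : x ∈ nonnegOrthant n) {a : ℝ}
    (ha : a < f x) : ∀ᶠ y in 𝓝[nonnegOrthant n] x, a < f y := by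
  obtain ⟨c, hc0, hc1, hca⟩ : ∃ c : ℝ, 0 < c ∧ c < 1 ∧ a < c * f x := by
    have ht : Tendsto (fun c : ℝ => c * f x) (𝓝[<] 1) (𝓝 (1 * f x)) :=
      ((continuous_id.mul continuous_const).tendsto 1).mono_left nhdsWithin_le_nhds
    rw [one_mul] at ht
    have h0 : ∀ᶠ c : ℝ in 𝓝[<] 1, 0 < c :=
      nhdsWithin_le_nhds (lt_mem_nhds one_pos)
    obtain ⟨c, ⟨h1, h2⟩, h3⟩ :=
      ((ht.eventually (lt_mem_nhds ha)).and h0 |>.and self_mem_nhdsWithin).exists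
    exact ⟨c, h2, h3, h1⟩
  have hev : ∀ᶠ y in 𝓝[nonnegOrthant n] x, ∀ i, c * x i ≤ y i := by
    refine eventually_all.2 fun i => ?_
    rcases (hx i).eq_or_lt with h | h
    · filter_upwards [self_mem_nhdsWithin] with y hy
      rw [← h, mul_zero]; exact hy i
    · have : c * x i < x i := by nlinarith
      exact nhdsWithin_le_nhds
        (((continuous_apply i).tendsto x).eventually (lt_mem_nhds this) |>.mono fun _ h => h.le)
  filter_upwards [hev] with y hy
  have h := hf.mono (smul_mem_nonnegOrthant hc0.le hx) (y := y) hy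
  rw [hf.homogeneous c hc0.le x hx] at h
  linarith

end Basic

/-! ### The gauge transform -/

section Gauge

variable {n : ℕ} {f : (Fin n → ℝ) → ℝ} {x p q : Fin n → ℝ}

theorem gaugeTransform_bddBelow (hp : p ∈ nonnegOrthant n) :
    BddBelow ((fun q => (q ⬝ᵥ p) / f q) '' {q | q ∈ nonnegOrthant n ∧ 0 < f q}) := by
  refine ⟨0, ?_⟩
  rintro _ ⟨q, ⟨hq, hfq⟩, rfl⟩
  exact div_nonneg (dotProduct_nonneg_of_mem hq hp) hfq.le

theorem gaugeTransform_le (hp : p ∈ nonnegOrthant n) (hq : q ∈ nonnegOrthant n)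
    (hfq : 0 < f q) : gaugeTransform f p ≤ (q ⬝ᵥ p) / f q :=
  csInf_le (gaugeTransform_bddBelow hp) ⟨q, ⟨hq, hfq⟩, rfl⟩

theorem le_gaugeTransform (hx : x ∈ nonnegOrthant n) (hfx : 0 < f x) {c : ℝ}
    (h : ∀ q ∈ nonnegOrthant n, 0 < f q → c * f q ≤ q ⬝ᵥ p) : c ≤ gaugeTransform f p := by
  refine le_csInf ⟨_, x, ⟨hx, hfx⟩, rfl⟩ ?_
  rintro _ ⟨q, ⟨hq, hfq⟩, rfl⟩
  exact (le_div_iff₀ hfq).2 (h q hq hfq)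

theorem mul_gaugeTransform_le (hp : p ∈ nonnegOrthant n) (hq : q ∈ nonnegOrthant n)
    (hfq : 0 < f q) : gaugeTransform f p * f q ≤ q ⬝ᵥ p :=
  (le_div_iff₀ hfq).1 (gaugeTransform_le hp hq hfq)

theorem gaugeTransform_nonneg (hp : p ∈ nonnegOrthant n) : 0 ≤ gaugeTransform f p := by
  refine Real.sInf_nonneg ?_
  rintro _ ⟨q, ⟨hq, hfq⟩, rfl⟩
  exact div_nonneg (dotProduct_nonneg_of_mem hq hp) hfq.le

theorem isUtility_gaugeTransform (hx : x ∈ nonnegOrthant n) (hfx : 0 < f x) :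
    IsUtility (gaugeTransform f) := by
  have hsub : ∀ c : ℝ, 0 ≤ c → ∀ p ∈ nonnegOrthant n,
      c * gaugeTransform f p ≤ gaugeTransform f (c • p) := fun c hc p hp =>
    le_gaugeTransform hx hfx fun q hq hfq => by
      rw [dotProduct_smul, smul_eq_mul, mul_assoc]
      exact mul_le_mul_of_nonneg_left (mul_gaugeTransform_le hp hq hfq) hc
  refine isUtility_of_add_le (fun p hp => gaugeTransform_nonneg hp) ?_ ?_
  · intro c hc p hp
    refine le_antisymm ?_ (hsub c hc p hp)
    rcases hc.eq_or_lt with rfl | hc'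
    · have h := gaugeTransform_le (smul_mem_nonnegOrthant le_rfl hp) hx hfx
      simpa using h
    · have h := hsub c⁻¹ (inv_nonneg.2 hc) (c • p) (smul_mem_nonnegOrthant hc hp)
      rw [smul_smul, inv_mul_cancel₀ hc'.ne', one_smul, inv_mul_le_iff₀ hc'] at h
      exact h
  · intro p hp p' hp'
    refine le_gaugeTransform hx hfx fun q hq hfq => ?_
    rw [dotProduct_add, add_mul]
    exact add_le_add (mul_gaugeTransform_le hp hq hfq) (mul_gaugeTransform_le hp' hq hfq)

/-- A gauge transform is upper semicontinuous as an infimum of linear functions, and lower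
semicontinuous on the closed orthant because it is itself a utility. -/
theorem continuousOn_gaugeTransform (hx : x ∈ nonnegOrthant n) (hfx : 0 < f x) :
    ContinuousOn (gaugeTransform f) (nonnegOrthant n) := by
  intro p hp
  refine tendsto_order.2 ⟨fun a ha => (isUtility_gaugeTransform hx hfx).eventually_lt hp ha, ?_⟩
  intro a ha
  have hne : {q | q ∈ nonnegOrthant n ∧ 0 < f q}.Nonempty := ⟨x, hx, hfx⟩
  obtain ⟨_, ⟨q, ⟨hq, hfq⟩, rfl⟩, hqa⟩ := exists_lt_of_csInf_lt (hne.image _) ha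
  have hc : Continuous fun y : Fin n → ℝ => (q ⬝ᵥ y) / f q :=
    (continuous_dotProduct_left q).div_const _
  filter_upwards [self_mem_nhdsWithin,
    nhdsWithin_le_nhds ((hc.tendsto p).eventually (gt_mem_nhds hqa))] with y hy hya
  exact (gaugeTransform_le hy hq hfq).trans_lt hya

end Gauge

/-! ### Rationalization by smooth utilities forces strict multipliers -/

section Rationalization

variable {n : ℕ} {f : (Fin n → ℝ) → ℝ} {x p q : Fin n → ℝ}

/-- A linear function that majorizes `f` on the orthant and touches it at an interior point is the
differential of `f` at that point. -/
theorem fderiv_apply_eq_dotProduct {a : Fin n → ℝ} (hx : x ∈ posOrthant n)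
    (hf : DifferentiableAt ℝ f x) (hle : ∀ y ∈ posOrthant n, f y ≤ a ⬝ᵥ y)
    (heq : f x = a ⬝ᵥ x) (v : Fin n → ℝ) : fderiv ℝ f x v = a ⬝ᵥ v := by
  have h1 : HasDerivAt (fun s : ℝ => f (x + s • v)) (fderiv ℝ f x v) 0 :=
    hf.hasFDerivAt.hasLineDerivAt v
  have h2 : HasDerivAt (fun s : ℝ => a ⬝ᵥ (x + s • v)) (a ⬝ᵥ v) 0 := by
    have : (fun s : ℝ => a ⬝ᵥ (x + s • v)) = fun s => a ⬝ᵥ x + s * (a ⬝ᵥ v) := by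
      ext s; rw [dotProduct_add, dotProduct_smul, smul_eq_mul]
    rw [this]
    simpa using ((hasDerivAt_id (0 : ℝ)).mul_const (a ⬝ᵥ v)).const_add (a ⬝ᵥ x)
  have hc : Tendsto (fun s : ℝ => x + s • v) (𝓝 0) (𝓝 x) := by
    have : Continuous fun s : ℝ => x + s • v := by fun_prop
    simpa using this.tendsto 0
  have hmax : IsLocalMax (fun s : ℝ => f (x + s • v) - a ⬝ᵥ (x + s • v)) 0 := by
    filter_upwards [hc.eventually (posOrthant_mem_nhds hx)] with s hs
    have := hle _ hs
    simp only [zero_smul, add_zero, heq, sub_self]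
    linarith
  have := hmax.hasDerivAt_eq_zero (h1.sub h2)
  linarith

theorem eq_of_majorize_of_touch {a b : Fin n → ℝ} (hx : x ∈ posOrthant n)
    (hf : DifferentiableAt ℝ f x)
    (ha : ∀ y ∈ nonnegOrthant n, f y ≤ a ⬝ᵥ y) (ha' : f x = a ⬝ᵥ x)
    (hb : ∀ y ∈ nonnegOrthant n, f y ≤ b ⬝ᵥ y) (hb' : f x = b ⬝ᵥ x) : a = b := by
  ext i
  have h1 := fderiv_apply_eq_dotProduct hx hf
    (fun y hy => ha y (posOrthant_subset_nonnegOrthant hy)) ha' (Pi.single i 1)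
  have h2 := fderiv_apply_eq_dotProduct hx hf
    (fun y hy => hb y (posOrthant_subset_nonnegOrthant hy)) hb' (Pi.single i 1)
  rw [h1] at h2
  simpa using h2

theorem IsBudgetArgmax.pos (hf : IsUtility f) (hx : x ∈ nonnegOrthant n) (hfx : 0 < f x)
    (hp : p ∈ nonnegOrthant n) (hpq : 0 < p ⬝ᵥ q) (h : IsBudgetArgmax f p q) : 0 < f q := by
  have h1 : (1 : Fin n → ℝ) ∈ posOrthant n := fun _ => one_pos
  have hp1 : 0 ≤ p ⬝ᵥ 1 := dotProduct_nonneg_of_mem hp (posOrthant_subset_nonnegOrthant h1)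
  have hc : 0 < (p ⬝ᵥ q) / (1 + p ⬝ᵥ 1) := by positivity
  have hle := h.2 ((p ⬝ᵥ q / (1 + p ⬝ᵥ 1)) • (1 : Fin n → ℝ))
    (smul_mem_nonnegOrthant hc.le (posOrthant_subset_nonnegOrthant h1)) (by
      rw [dotProduct_smul, smul_eq_mul, div_mul_eq_mul_div, div_le_iff₀ (by positivity)]
      nlinarith)
  rw [hf.homogeneous _ hc.le _ (posOrthant_subset_nonnegOrthant h1)] at hle
  exact lt_of_lt_of_le (mul_pos hc (hf.pos_of_mem_posOrthant hx hfx h1)) hle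

/-- By homogeneity, a demanded bundle has the best utility-to-cost ratio of all bundles. -/
theorem IsBudgetArgmax.mul_le (hf : IsUtility f) (hpq : 0 < p ⬝ᵥ q)
    (hp : p ∈ nonnegOrthant n) (h : IsBudgetArgmax f p q) {y : Fin n → ℝ}
    (hy : y ∈ nonnegOrthant n) : f y * (p ⬝ᵥ q) ≤ f q * (p ⬝ᵥ y) := by
  rcases (dotProduct_nonneg_of_mem hp hy).eq_or_lt with h0 | h0
  · -- every multiple of a costless bundle is affordable, so its utility vanishes
    have hfy : f y ≤ 0 := by
      by_contra! hfy
      have hc : 0 ≤ (f q + 1) / f y := div_nonneg (by linarith [hf.nonneg q h.1]) hfy.le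
      have := h.2 _ (smul_mem_nonnegOrthant hc hy) (by
        rw [dotProduct_smul, ← h0, smul_zero]; exact hpq.le)
      rw [hf.homogeneous _ hc _ hy, div_mul_cancel₀ _ hfy.ne'] at this
      linarith
    rw [← h0, mul_zero]
    exact mul_nonpos_of_nonpos_of_nonneg hfy hpq.le
  · have hc : 0 ≤ (p ⬝ᵥ q) / (p ⬝ᵥ y) := by positivity
    have := h.2 _ (smul_mem_nonnegOrthant hc hy) (by
      rw [dotProduct_smul, smul_eq_mul, div_mul_cancel₀ _ h0.ne'])
    rw [hf.homogeneous _ hc _ hy, div_mul_eq_mul_div, div_le_iff₀ h0] at this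
    linarith

theorem sameRay_of_pos_smul_eq {a b : ℝ} (ha : 0 < a) (hb : 0 < b) (h : a • p = b • q) :
    SameRay ℝ p q := Or.inr (Or.inr ⟨a, b, ha, hb, h⟩)

theorem dotProduct_pos_of_positivity {T : ℕ} {p q : Fin T → Fin n → ℝ}
    (hp : ∀ t, p t ∈ nonnegOrthant n ∧ p t ≠ 0) (hq : ∀ t, q t ∈ nonnegOrthant n ∧ q t ≠ 0)
    (hpos : (∀ t, p t ∈ posOrthant n) ∨ ∀ t, q t ∈ posOrthant n) (t τ : Fin T) :
    0 < p t ⬝ᵥ q τ := by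
  rcases hpos with h | h
  · exact dotProduct_pos_of_mem (h t) (hq τ).1 (hq τ).2
  · rw [dotProduct_comm]
    exact dotProduct_pos_of_mem (h τ) (hp t).1 (hp t).2

/-- The multipliers `l t = Q (q t) / (p t q t)` satisfy the weak inequalities. An equality makes
`q t` optimal for both `p t` and `p τ`. Differentiability of the utility at an interior `q t` then
makes the two prices proportional, and differentiability of the gauge transform at an interior `p τ`
makes the two quantities proportional. -/
theorem exists_strict_multipliers_of_smooth_rationalization {T k : ℕ} (hk : 1 ≤ k)
    {p q : Fin T → Fin n → ℝ}
    (hp : ∀ t, p t ∈ nonnegOrthant n ∧ p t ≠ 0)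
    (hq : ∀ t, q t ∈ nonnegOrthant n ∧ q t ≠ 0)
    (hdistinct : ∀ t τ, t ≠ τ → ¬ (SameRay ℝ (p t) (p τ) ∧ SameRay ℝ (q t) (q τ)))
    (hpos :
      ((∀ t, p t ∈ posOrthant n) ∧
        ∀ t τ, t ≠ τ → SameRay ℝ (q t) (q τ) → q t ∈ posOrthant n) ∨
      ((∀ t, q t ∈ posOrthant n) ∧
        ∀ t τ, t ≠ τ → SameRay ℝ (p t) (p τ) → p t ∈ posOrthant n))
    (h : ∃ Q : (Fin n → ℝ) → ℝ, IsSmoothUtility k Q ∧ ∀ t, IsBudgetArgmax Q (p t) (q t)) :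
    ∃ l : Fin T → ℝ, (∀ t, 0 < l t) ∧
      ∀ t τ, t ≠ τ → l t * (p t ⬝ᵥ q t) < l τ * (p τ ⬝ᵥ q t) := by
  obtain ⟨Q, hQ, hmax⟩ := h
  have hU := hQ.isUtility
  obtain ⟨x, hx, hQx⟩ : ∃ x ∈ nonnegOrthant n, 0 < Q x := by
    obtain ⟨x, hx, hne⟩ := hQ.nontrivial
    exact ⟨x, hx, lt_of_le_of_ne (hU.nonneg x hx) (Ne.symm hne)⟩
  have hpq := dotProduct_pos_of_positivity hp hq (hpos.imp And.left And.left)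
  have hQq : ∀ t, 0 < Q (q t) := fun t => (hmax t).pos hU hx hQx (hp t).1 (hpq t t)
  have hk0 : (k : WithTop ℕ∞) ≠ 0 := by exact_mod_cast (by omega : k ≠ 0)
  have hl : ∀ t, 0 < Q (q t) / (p t ⬝ᵥ q t) := fun t => div_pos (hQq t) (hpq t t)
  have hle : ∀ t, ∀ y ∈ nonnegOrthant n, Q y ≤ ((Q (q t) / (p t ⬝ᵥ q t)) • p t) ⬝ᵥ y := by
    intro t y hy
    rw [smul_dotProduct, smul_eq_mul, div_mul_eq_mul_div, le_div_iff₀ (hpq t t)]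
    exact (hmax t).mul_le hU (hpq t t) (hp t).1 hy
  have heq : ∀ t, Q (q t) = ((Q (q t) / (p t ⬝ᵥ q t)) • p t) ⬝ᵥ q t := fun t => by
    rw [smul_dotProduct, smul_eq_mul, div_mul_cancel₀ _ (hpq t t).ne']
  refine ⟨fun t => Q (q t) / (p t ⬝ᵥ q t), hl, fun t τ hne => ?_⟩
  have h1 := hle τ _ (hq t).1
  rw [smul_dotProduct, smul_eq_mul] at h1
  simp only [div_mul_cancel₀ _ (hpq t t).ne']
  refine lt_of_le_of_ne h1 fun he => ?_
  have hpray : q t ∈ posOrthant n → SameRay ℝ (p t) (p τ) := fun hqt =>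
    sameRay_of_pos_smul_eq (hl t) (hl τ) <|
      eq_of_majorize_of_touch hqt
        ((hQ.smooth.2.contDiffAt (posOrthant_mem_nhds hqt)).differentiableAt hk0)
        (hle t) (heq t) (hle τ) (by rw [smul_dotProduct, smul_eq_mul, ← he])
  have hqray : p τ ∈ posOrthant n → SameRay ℝ (q t) (q τ) := fun hpτ => by
    have hG : gaugeTransform Q (p τ) = (q τ ⬝ᵥ p τ) / Q (q τ) :=
      le_antisymm (gaugeTransform_le (hp τ).1 (hq τ).1 (hQq τ)) <|
        le_gaugeTransform hx hQx fun y hy _ => by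
          rw [div_mul_eq_mul_div, div_le_iff₀ (hQq τ), dotProduct_comm, dotProduct_comm y]
          have := (hmax τ).mul_le hU (hpq τ τ) (hp τ).1 hy
          linarith
    have hmaj : ∀ s, ∀ y ∈ nonnegOrthant n, gaugeTransform Q y ≤ ((Q (q s))⁻¹ • q s) ⬝ᵥ y :=
      fun s y hy => by
        rw [smul_dotProduct, smul_eq_mul, inv_mul_eq_div]
        exact gaugeTransform_le hy (hq s).1 (hQq s)
    refine sameRay_of_pos_smul_eq (inv_pos.2 (hQq t)) (inv_pos.2 (hQq τ)) <|
      eq_of_majorize_of_touch hpτ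
        ((hQ.smooth_gauge.2.contDiffAt (posOrthant_mem_nhds hpτ)).differentiableAt hk0)
        (hmaj t) ?_ (hmaj τ) ?_
    · have h2 := hpq τ t
      have h3 := hpq τ τ
      have h4 := hQq t
      have h5 := hQq τ
      rw [hG, smul_dotProduct, smul_eq_mul, dotProduct_comm (q τ), dotProduct_comm (q t)]
      rw [div_mul_eq_mul_div, eq_div_iff h3.ne'] at he
      field_simp
      linarith
    · rw [hG, smul_dotProduct, smul_eq_mul, inv_mul_eq_div]
  rcases hpos with ⟨h2, h3⟩ | ⟨h2, h3⟩
  · have h4 := hqray (h2 τ)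
    exact hdistinct t τ hne ⟨hpray (h3 t τ hne h4), h4⟩
  · have h4 := hpray (h2 t)
    exact hdistinct t τ hne ⟨h4, hqray (h3 τ t hne.symm h4.symm)⟩

end Rationalization

/-! ### Potentials for weights with positive simple cycles -/

section Potential

variable {α : Type*}

/-- The total weight of the steps of the path that starts at `a` and visits the nodes of a list. -/
def pathWeight (w : α → α → ℝ) : α → List α → ℝ
  | _, [] => 0
  | a, b :: l => w a b + pathWeight w b l

theorem pathWeight_append (w : α → α → ℝ) (a b : α) (l₁ l₂ : List α) :
    pathWeight w a (l₁ ++ b :: l₂) = pathWeight w a (l₁ ++ [b]) + pathWeight w b l₂ := by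
  induction l₁ generalizing a with
  | nil => simp [pathWeight]
  | cons c l ih => simp only [List.cons_append, pathWeight, ih, add_assoc]

theorem pathWeight_ofFn (w : α → α → ℝ) {m : ℕ} (f : Fin (m + 1) → α) :
    pathWeight w (f 0) (List.ofFn fun i : Fin m => f i.succ) =
      ∑ i : Fin m, w (f i.castSucc) (f i.succ) := by
  induction m with
  | zero => simp [pathWeight]
  | succ m ih =>
    rw [List.ofFn_succ, pathWeight, Fin.sum_univ_succ]
    exact congrArg _ (ih fun i => f i.succ)

/-- The weight of a closed path in terms of the cyclic order of its nodes. -/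
theorem pathWeight_closed (w : α → α → ℝ) {m : ℕ} (f : Fin (m + 1) → α) :
    pathWeight w (f 0) ((List.ofFn fun i : Fin m => f i.succ) ++ [f 0]) =
      ∑ i, w (f i) (f (i + 1)) := by
  have h := pathWeight_ofFn w (Fin.snoc f (f 0) : Fin (m + 2) → α)
  have h0 : (Fin.snoc f (f 0) : Fin (m + 2) → α) 0 = f 0 :=
    Fin.snoc_castSucc (α := fun _ => α) (f 0) f 0
  have hs : ∀ i : Fin m, (Fin.snoc f (f 0) : Fin (m + 2) → α) i.castSucc.succ = f i.succ := by
    intro i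
    rw [Fin.succ_castSucc, Fin.snoc_castSucc]
  have hlast : (Fin.snoc f (f 0) : Fin (m + 2) → α) (Fin.last m).succ = f 0 := by
    rw [Fin.succ_last, Fin.snoc_last]
  rw [h0, List.ofFn_succ', List.concat_eq_append, hlast] at h
  simp only [hs] at h
  rw [h]
  refine Finset.sum_congr rfl fun i _ => ?_
  rw [Fin.snoc_castSucc]
  refine Fin.lastCases ?_ (fun j => ?_) i
  · rw [hlast, Fin.last_add_one]
  · rw [hs, Fin.coeSucc_eq_succ]

/-- If no simple cycle has negative weight, the least weight of a simple path that starts at a node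
is a potential. -/
theorem exists_potential_of_cycle_nonneg [Fintype α] (w : α → α → ℝ)
    (hw : ∀ (m : ℕ) (t : Fin (m + 2) → α), Function.Injective t →
      0 ≤ ∑ i, w (t i) (t (i + 1))) :
    ∃ d : α → ℝ, ∀ a b, a ≠ b → d a ≤ w a b + d b := by
  classical
  let S : α → Type _ := fun a => {l : List α // (a :: l).Nodup}
  have hfin : ∀ a, Finite (S a) := fun a =>
    Finite.of_injective (β := {l : List α // l.Nodup}) (fun l => ⟨l.1, (List.nodup_cons.1 l.2).2⟩)
      fun l l' h => Subtype.ext (by simpa using h)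
  have hne : ∀ a, Nonempty (S a) := fun a => ⟨⟨[], by simp⟩⟩
  let d : α → ℝ := fun a => ⨅ l : S a, pathWeight w a l.1
  have hd : ∀ a (l : List α), (a :: l).Nodup → d a ≤ pathWeight w a l := fun a l h =>
    ciInf_le (f := fun l : S a => pathWeight w a l.1) (Set.finite_range _).bddBelow ⟨l, h⟩
  refine ⟨d, fun a b hab => ?_⟩
  obtain ⟨⟨l, hl⟩, hl'⟩ := exists_eq_ciInf_of_finite (f := fun l : S b => pathWeight w b l.1)
  change _ ≤ _ + ⨅ l : S b, pathWeight w b l.1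
  rw [← hl']
  by_cases hal : a ∈ l
  · -- cut off the simple cycle that the step from `a` to `b` closes
    obtain ⟨l₁, l₂, rfl⟩ := List.append_of_mem hal
    have h1 := hd a l₂ ((List.nodup_append.1 (List.nodup_cons.1 hl).2).2.1)
    have hc : (a :: b :: l₁).Nodup := by
      rw [List.nodup_cons, List.nodup_append, List.nodup_cons] at hl
      rw [List.nodup_cons, List.nodup_cons]
      refine ⟨?_, fun h => hl.1 (List.mem_append_left _ h), hl.2.1⟩
      rw [List.mem_cons, not_or]
      exact ⟨hab, fun h => hl.2.2.2 a h a (by simp) rfl⟩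
    have h2 : 0 ≤ pathWeight w a (b :: l₁ ++ [a]) := by
      have h3 := hw l₁.length (fun i => (a :: b :: l₁).get i) hc.injective_get
      rw [← pathWeight_closed] at h3
      have h4 : (List.ofFn fun i : Fin (l₁.length + 1) => (a :: b :: l₁).get i.succ) = b :: l₁ :=
        List.ofFn_get (b :: l₁)
      rw [h4] at h3
      exact h3
    have h5 := pathWeight_append w b a l₁ l₂
    simp only [List.cons_append, pathWeight] at h2
    simp only [h5]
    linarith
  · exact hd a (b :: l) (List.nodup_cons.2 ⟨by simp [hab, hal], hl⟩)

/-- If every simple cycle of length at least two has positive weight, all steps can be shortened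
by a common positive amount, so the potential inequalities hold strictly. -/
theorem exists_strict_potential_of_cycle_pos [Fintype α] (w : α → α → ℝ)
    (hw : ∀ (m : ℕ) (t : Fin (m + 2) → α), Function.Injective t →
      0 < ∑ i, w (t i) (t (i + 1))) :
    ∃ d : α → ℝ, ∀ a b, a ≠ b → d a < w a b + d b := by
  have hev : ∀ᶠ ε : ℝ in 𝓝[>] 0, ∀ m : Fin (Fintype.card α), ∀ t : Fin (m + 2) → α,
      Function.Injective t → 0 ≤ ∑ i, (w (t i) (t (i + 1)) - ε) := by
    refine eventually_all.2 fun m => eventually_all.2 fun t => ?_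
    by_cases ht : Function.Injective t
    · have hc : Continuous fun ε : ℝ => ∑ i, (w (t i) (t (i + 1)) - ε) := by fun_prop
      have := (hc.tendsto 0).eventually (lt_mem_nhds (a := 0) (by simpa using hw m t ht))
      exact nhdsWithin_le_nhds (this.mono fun _ h _ => h.le)
    · exact Eventually.of_forall fun _ h => absurd h ht
  obtain ⟨ε, hε, hε0⟩ := (hev.and self_mem_nhdsWithin).exists
  obtain ⟨d, hd⟩ := exists_potential_of_cycle_nonneg (fun a b => w a b - ε) fun m t ht => by
    have hm : m < Fintype.card α := by
      have := Fintype.card_le_of_injective t ht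
      rw [Fintype.card_fin] at this
      omega
    exact hε ⟨m, hm⟩ t ht
  refine ⟨d, fun a b hab => ?_⟩
  have := hd a b hab
  have h0 : 0 < ε := hε0
  linarith

end Potential

/-! ### The strict homogeneous strong axiom and the multipliers -/

section Axiom

variable {n T : ℕ} {p q : Fin T → Fin n → ℝ}

theorem StrictHomogeneousStrongAxiom.exists_multipliers (hpq : ∀ t τ, 0 < p t ⬝ᵥ q τ)
    (h : StrictHomogeneousStrongAxiom p q) :
    ∃ l : Fin T → ℝ, (∀ t, 0 < l t) ∧
      ∀ t τ, t ≠ τ → l t * (p t ⬝ᵥ q t) < l τ * (p τ ⬝ᵥ q t) := by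
  obtain ⟨d, hd⟩ := exists_strict_potential_of_cycle_pos
    (fun a b => Real.log (p a ⬝ᵥ q b) - Real.log (p b ⬝ᵥ q b)) fun m t ht => by
      have h1 := Real.log_lt_log (Finset.prod_pos fun i _ => hpq (t i) (t i)) (h m t ht)
      rw [Real.log_prod fun i _ => (hpq _ _).ne', Real.log_prod fun i _ => (hpq _ _).ne'] at h1
      have h2 := Equiv.sum_comp (Equiv.addRight 1) fun i => Real.log (p (t i) ⬝ᵥ q (t i))
      simp only [Equiv.coe_addRight] at h2
      rw [Finset.sum_sub_distrib, h2]
      linarith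
  refine ⟨fun t => Real.exp (-d t), fun t => Real.exp_pos _, fun t τ hne => ?_⟩
  have h1 := hd τ t hne.symm
  rw [← Real.log_lt_log_iff (mul_pos (Real.exp_pos _) (hpq _ _))
    (mul_pos (Real.exp_pos _) (hpq _ _)), Real.log_mul (Real.exp_ne_zero _) (hpq _ _).ne',
    Real.log_mul (Real.exp_ne_zero _) (hpq _ _).ne', Real.log_exp, Real.log_exp]
  linarith

theorem strictHomogeneousStrongAxiom_of_multipliers (hpq : ∀ t τ, 0 < p t ⬝ᵥ q τ)
    {l : Fin T → ℝ} (hl : ∀ t, 0 < l t)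
    (h : ∀ t τ, t ≠ τ → l t * (p t ⬝ᵥ q t) < l τ * (p τ ⬝ᵥ q t)) :
    StrictHomogeneousStrongAxiom p q := by
  intro m t ht
  have h1 : ∏ i, (l (t (i + 1)) * (p (t (i + 1)) ⬝ᵥ q (t (i + 1)))) <
      ∏ i, (l (t i) * (p (t i) ⬝ᵥ q (t (i + 1)))) := by
    refine Finset.prod_lt_prod_of_nonempty (fun i _ => mul_pos (hl _) (hpq _ _))
      (fun i _ => h _ _ fun he => ?_) Finset.univ_nonempty
    have := ht he
    simp at this
  have h2 := Equiv.prod_comp (Equiv.addRight 1) fun i => l (t i) * (p (t i) ⬝ᵥ q (t i))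
  simp only [Equiv.coe_addRight] at h2
  rw [h2, Finset.prod_mul_distrib, Finset.prod_mul_distrib] at h1
  exact lt_of_mul_lt_mul_left h1 (Finset.prod_nonneg fun i _ => (hl _).le)

/-- The two systems of multipliers correspond to each other by `μ t = 1 / (l t * (p t q t))`. -/
theorem exists_dual_multipliers (hpq : ∀ t τ, 0 < p t ⬝ᵥ q τ)
    (h : ∃ l : Fin T → ℝ, (∀ t, 0 < l t) ∧
      ∀ t τ, t ≠ τ → l t * (p t ⬝ᵥ q t) < l τ * (p τ ⬝ᵥ q t)) :
    ∃ μ : Fin T → ℝ, (∀ t, 0 < μ t) ∧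
      ∀ t τ, t ≠ τ → μ t * (p t ⬝ᵥ q t) < μ τ * (p t ⬝ᵥ q τ) := by
  obtain ⟨l, hl, h⟩ := h
  refine ⟨fun t => (l t * (p t ⬝ᵥ q t))⁻¹,
    fun t => inv_pos.2 (mul_pos (hl t) (hpq t t)), fun t τ hne => ?_⟩
  have h1 := h τ t hne.symm
  have h2 := hl t
  have h3 := hl τ
  have h4 := hpq t t
  have h5 := hpq τ τ
  beta_reduce
  rw [mul_inv, inv_mul_cancel_right₀ h4.ne', inv_mul_eq_div, lt_div_iff₀ (by positivity),
    inv_mul_eq_div, div_lt_iff₀ h2]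
  linarith

end Axiom

/-! ### Smooth gauges that are strictly concave where they increase -/

/-- The second derivative of `f` at `x` in the direction `v`. -/
noncomputable def secondDeriv {n : ℕ} (f : (Fin n → ℝ) → ℝ) (x v : Fin n → ℝ) : ℝ :=
  deriv (deriv fun s : ℝ => f (x + s • v)) 0

/-- Utilities that are positive and smooth in the interior of the orthant and as strictly concave
there as homogeneity and monotonicity allow: the second derivative may vanish only in directions
which, on the coordinates of nonzero marginal utility, are radial. -/
structure IsStrictSmoothGauge {n : ℕ} (f : (Fin n → ℝ) → ℝ) : Prop where
  isUtility : IsUtility f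
  continuousOn : ContinuousOn f (nonnegOrthant n)
  contDiffOn : ContDiffOn ℝ ∞ f (posOrthant n)
  pos : ∀ x ∈ posOrthant n, 0 < f x
  secondDeriv_nonpos : ∀ x ∈ posOrthant n, ∀ v, secondDeriv f x v ≤ 0
  radial_of_secondDeriv_eq_zero : ∀ x ∈ posOrthant n, ∀ v, secondDeriv f x v = 0 →
    ∃ c : ℝ, ∀ i, fderiv ℝ f x (Pi.single i 1) ≠ 0 → v i = c * x i

section Line

variable {n : ℕ} {f : (Fin n → ℝ) → ℝ} {x v : Fin n → ℝ}

theorem tendsto_line (x v : Fin n → ℝ) : Tendsto (fun s : ℝ => x + s • v) (𝓝 0) (𝓝 x) := by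
  have : Continuous fun s : ℝ => x + s • v := by fun_prop
  simpa using this.tendsto 0

theorem eventually_line_mem (hx : x ∈ posOrthant n) (v : Fin n → ℝ) :
    ∀ᶠ s : ℝ in 𝓝 0, x + s • v ∈ posOrthant n :=
  (tendsto_line x v).eventually (posOrthant_mem_nhds hx)

theorem hasDerivAt_line {s : ℝ} (hf : DifferentiableAt ℝ f (x + s • v)) :
    HasDerivAt (fun s : ℝ => f (x + s • v)) (fderiv ℝ f (x + s • v) v) s := by
  have h : HasDerivAt (fun s : ℝ => x + s • v) v s := by
    simpa using ((hasDerivAt_id s).smul_const v).const_add x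
  exact hf.hasFDerivAt.comp_hasDerivAt s h

theorem contDiffAt_line {m : WithTop ℕ∞} (hf : ContDiffAt ℝ m f x) :
    ContDiffAt ℝ m (fun s : ℝ => f (x + s • v)) 0 := by
  have h : ContDiffAt ℝ m (fun s : ℝ => x + s • v) 0 := by fun_prop
  refine ContDiffAt.comp (0 : ℝ) ?_ h
  simpa using hf

theorem map_eq_sum_mul_single (L : (Fin n → ℝ) →L[ℝ] ℝ) (v : Fin n → ℝ) :
    L v = ∑ i, v i * L (Pi.single i 1) := by
  conv_lhs => rw [pi_eq_sum_univ' v]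
  rw [map_sum]
  refine Finset.sum_congr rfl fun i _ => ?_
  rw [map_smul, smul_eq_mul]

/-- A twice continuously differentiable function of one variable is differentiable near the point,
and so is its derivative at the point. -/
theorem ContDiffAt.hasDerivAt_deriv {z : ℝ → ℝ} {a : ℝ} (hz : ContDiffAt ℝ 2 z a) :
    (∀ᶠ s in 𝓝 a, HasDerivAt z (deriv z s) s) ∧ HasDerivAt (deriv z) (deriv (deriv z) a) a := by
  constructor
  · filter_upwards [hz.eventually (by simp)] with s hs
    exact (hs.differentiableAt (by simp)).hasDerivAt
  · have h : ContDiffAt ℝ 1 (fun s => fderiv ℝ z s 1) a :=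
      (hz.fderiv_right (by norm_num)).clm_apply contDiffAt_const
    exact (h.differentiableAt (by simp)).hasDerivAt

end Line

/-- The logarithmic gradient of `f`. -/
noncomputable def logGradient {n : ℕ} (f : (Fin n → ℝ) → ℝ) (x : Fin n → ℝ) : Fin n → ℝ :=
  fun i => fderiv ℝ f x (Pi.single i 1) / f x

theorem dotProduct_logGradient {n : ℕ} (f : (Fin n → ℝ) → ℝ) (x v : Fin n → ℝ) :
    v ⬝ᵥ logGradient f x = fderiv ℝ f x v / f x := by
  rw [map_eq_sum_mul_single _ v, Finset.sum_div]
  exact Finset.sum_congr rfl fun i _ => by rw [logGradient, mul_div_assoc]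

namespace IsStrictSmoothGauge

variable {n : ℕ} {f : (Fin n → ℝ) → ℝ} {x v : Fin n → ℝ}

theorem contDiffAt (hf : IsStrictSmoothGauge f) (hx : x ∈ posOrthant n) : ContDiffAt ℝ ∞ f x :=
  hf.contDiffOn.contDiffAt (posOrthant_mem_nhds hx)

theorem differentiableAt (hf : IsStrictSmoothGauge f) (hx : x ∈ posOrthant n) :
    DifferentiableAt ℝ f x := (hf.contDiffAt hx).differentiableAt (by simp)

theorem contDiffAt_line (hf : IsStrictSmoothGauge f) (hx : x ∈ posOrthant n) :
    ContDiffAt ℝ 2 (fun s : ℝ => f (x + s • v)) 0 :=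
  _root_.contDiffAt_line
    ((hf.contDiffAt hx).of_le (WithTop.coe_le_coe.2 (le_top : (2 : ℕ∞) ≤ ⊤)))

theorem deriv_line (hf : IsStrictSmoothGauge f) (hx : x ∈ posOrthant n) :
    deriv (fun s : ℝ => f (x + s • v)) 0 = fderiv ℝ f x v := by
  have h := hasDerivAt_line (f := f) (x := x) (v := v) (s := 0)
    (by simpa only [zero_smul, add_zero] using hf.differentiableAt hx)
  simpa only [zero_smul, add_zero] using h.deriv

/-- Euler's identity. -/
theorem fderiv_self (hf : IsStrictSmoothGauge f) (hx : x ∈ posOrthant n) :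
    fderiv ℝ f x x = f x := by
  rw [← hf.deriv_line hx]
  have h : (fun s : ℝ => f (x + s • x)) =ᶠ[𝓝 0] fun s => (1 + s) * f x := by
    filter_upwards [lt_mem_nhds (show (-1 : ℝ) < 0 by norm_num)] with s hs
    rw [← hf.isUtility.homogeneous (1 + s) (by linarith) x (posOrthant_subset_nonnegOrthant hx),
      add_smul, one_smul]
  rw [h.deriv_eq]
  simp

theorem fderiv_apply_of_radial (hf : IsStrictSmoothGauge f) (hx : x ∈ posOrthant n) {c : ℝ}
    (hc : ∀ i, fderiv ℝ f x (Pi.single i 1) ≠ 0 → v i = c * x i) :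
    fderiv ℝ f x v = c * f x := by
  rw [← hf.fderiv_self hx, map_eq_sum_mul_single _ v, map_eq_sum_mul_single _ x, Finset.mul_sum]
  refine Finset.sum_congr rfl fun i _ => ?_
  by_cases h : fderiv ℝ f x (Pi.single i 1) = 0
  · simp [h]
  · rw [hc i h, mul_assoc]

/-- The tangent hyperplane of a concave homogeneous function majorizes it. -/
theorem le_fderiv_apply (hf : IsStrictSmoothGauge f) (hx : x ∈ posOrthant n)
    {y : Fin n → ℝ} (hy : y ∈ nonnegOrthant n) : f y ≤ fderiv ℝ f x y := by
  have h1 := (hasDerivAt_line (f := f) (x := x) (v := y) (s := 0)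
    (by simpa using hf.differentiableAt hx)).hasDerivWithinAt (s := Ioi 0)
  simp only [zero_smul, add_zero] at h1
  rw [hasDerivWithinAt_iff_tendsto_slope' (by simp)] at h1
  refine ge_of_tendsto h1 ?_
  filter_upwards [self_mem_nhdsWithin] with s hs
  have hs0 : (0 : ℝ) < s := hs
  have h2 := hf.isUtility.add_le (posOrthant_subset_nonnegOrthant hx)
    (smul_mem_nonnegOrthant hs0.le hy)
  rw [hf.isUtility.homogeneous s hs0.le y hy] at h2
  simp only [slope_def_field, zero_smul, add_zero, sub_zero]
  rw [le_div_iff₀ hs0]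
  linarith

/-! ### Smoothness of the dual gauge and biduality -/

theorem contDiffAt_logGradient (hf : IsStrictSmoothGauge f) (hx : x ∈ posOrthant n) :
    ContDiffAt ℝ ∞ (logGradient f) x := by
  refine contDiffAt_pi.2 fun i => ContDiffAt.div ?_ (hf.contDiffAt hx) (hf.pos x hx).ne'
  have h : ContDiffAt ℝ ∞ (fderiv ℝ f) x := (hf.contDiffAt hx).fderiv_right (by simp)
  exact h.clm_apply contDiffAt_const

/-- At a point where all marginal utilities are nonzero, the differential of the logarithmic
gradient, which is the Hessian of `log f`, is nondegenerate: by homogeneity the only directions in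
which `f` itself is not strictly concave are radial, and there `log f` is strictly concave. -/
theorem eq_zero_of_fderiv_logGradient_eq_zero (hf : IsStrictSmoothGauge f)
    (hx : x ∈ posOrthant n) (hgrad : ∀ i, fderiv ℝ f x (Pi.single i 1) ≠ 0)
    (hv : fderiv ℝ (logGradient f) x v = 0) : v = 0 := by
  have hpos := hf.pos x hx
  set z : ℝ → ℝ := fun s => f (x + s • v) with hz
  have hzC : ContDiffAt ℝ 2 z 0 := hf.contDiffAt_line hx
  obtain ⟨hz1, hz2⟩ := hzC.hasDerivAt_deriv
  have hz0 : z 0 = f x := by simp [hz]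
  -- differentiate `v ⬝ᵥ logGradient f (x + s • v) = z' s / z s` at `s = 0` in two ways
  have h1 : HasDerivAt (fun s : ℝ => v ⬝ᵥ logGradient f (x + s • v)) 0 0 := by
    have h2 : HasDerivAt (fun s : ℝ => logGradient f (x + s • v)) 0 0 := by
      have h3 := ((hf.contDiffAt_logGradient hx).differentiableAt (by simp)).hasFDerivAt
        |>.hasLineDerivAt v
      rw [hv] at h3
      exact h3
    have h4 := HasDerivAt.fun_sum (u := Finset.univ) fun i _ =>
      ((hasDerivAt_pi.1 h2 i).const_mul (v i))
    simpa [dotProduct] using h4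
  have h2 : (fun s : ℝ => v ⬝ᵥ logGradient f (x + s • v)) =ᶠ[𝓝 0] fun s => deriv z s / z s := by
    filter_upwards [eventually_line_mem hx v] with s hs
    rw [dotProduct_logGradient, (hasDerivAt_line (hf.differentiableAt hs)).deriv]
  have h3 := (hz2.div hz1.self_of_nhds (by rw [hz0]; exact hpos.ne')).unique
    (h2.hasDerivAt_iff.1 h1)
  rw [hz0, div_eq_zero_iff, or_iff_left (by positivity)] at h3
  have h4 : secondDeriv f x v ≤ 0 := hf.secondDeriv_nonpos x hx v
  change deriv (deriv z) 0 ≤ 0 at h4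
  have h5 : deriv z 0 = 0 := by
    nlinarith [sq_nonneg (deriv z 0),
      mul_nonneg_of_nonpos_of_nonpos h4 (neg_nonpos.2 hpos.le)]
  have h6 : secondDeriv f x v = 0 := by
    rw [h5, mul_zero, sub_zero, mul_eq_zero, or_iff_left hpos.ne'] at h3
    exact h3
  obtain ⟨c, hc⟩ := hf.radial_of_secondDeriv_eq_zero x hx v h6
  have h7 := hf.fderiv_apply_of_radial hx fun i _ => hc i (hgrad i)
  rw [← hf.deriv_line hx] at h7
  have hc0 : c = 0 := (mul_eq_zero.1 (h7.symm.trans h5)).resolve_right hpos.ne'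
  ext i
  rw [hc i (hgrad i), hc0, zero_mul, Pi.zero_apply]

/-- At an interior `x`, the gauge transform of the logarithmic gradient is `1 / f x`. -/
theorem gaugeTransform_logGradient (hf : IsStrictSmoothGauge f) (hx : x ∈ posOrthant n)
    (hq : logGradient f x ∈ nonnegOrthant n) : gaugeTransform f (logGradient f x) = (f x)⁻¹ := by
  have hpos := hf.pos x hx
  refine le_antisymm ?_ ?_
  · have h := gaugeTransform_le hq (posOrthant_subset_nonnegOrthant hx) hpos
    rwa [dotProduct_logGradient, hf.fderiv_self hx, div_self hpos.ne', one_div] at h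
  · refine le_gaugeTransform (posOrthant_subset_nonnegOrthant hx) hpos fun y hy _ => ?_
    rw [dotProduct_logGradient, inv_mul_eq_div]
    exact div_le_div_of_nonneg_right (hf.le_fderiv_apply hx hy) hpos.le

theorem logGradient_nonneg (hf : IsStrictSmoothGauge f) (hx : x ∈ posOrthant n) :
    logGradient f x ∈ nonnegOrthant n := fun i => by
  refine div_nonneg ?_ (hf.pos x hx).le
  have hi : (Pi.single i 1 : Fin n → ℝ) ∈ nonnegOrthant n := fun j => by
    by_cases h : j = i
    · subst h; simp
    · simp [h]
  exact (hf.isUtility.nonneg _ hi).trans (hf.le_fderiv_apply hx hi)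

/-- A gauge that vanishes on the boundary of the orthant attains its maximum on every budget set
with positive prices in the interior; so every interior price vector is a logarithmic gradient. -/
theorem exists_logGradient_eq (hf : IsStrictSmoothGauge f)
    (hbd : ∀ x ∈ nonnegOrthant n, x ∉ posOrthant n → f x = 0)
    {q : Fin n → ℝ} (hq : q ∈ posOrthant n) : ∃ x ∈ posOrthant n, logGradient f x = q := by
  have h1 : (1 : Fin n → ℝ) ∈ posOrthant n := fun _ => one_pos
  have hq1 : 0 < q ⬝ᵥ 1 := by
    refine dotProduct_pos_of_mem hq (posOrthant_subset_nonnegOrthant h1) fun h0 => ?_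
    have := hf.pos 1 h1
    rw [h0, hf.isUtility.map_zero] at this
    exact this.false
  let S : Set (Fin n → ℝ) := {x | x ∈ nonnegOrthant n ∧ q ⬝ᵥ x = 1}
  have hS : IsCompact S := by
    refine IsCompact.of_isClosed_subset (isCompact_Icc (a := (0 : Fin n → ℝ))
      (b := fun i => (q i)⁻¹))
      (isClosed_nonnegOrthant.inter (isClosed_eq (continuous_dotProduct_left q) continuous_const)) ?_
    rintro x ⟨hx, hqx⟩
    refine ⟨fun i => hx i, fun i => ?_⟩
    have h2 : q i * x i ≤ q ⬝ᵥ x :=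
      Finset.single_le_sum (f := fun i => q i * x i) (fun j _ => mul_nonneg (hq j).le (hx j))
        (Finset.mem_univ i)
    show x i ≤ (q i)⁻¹
    rw [← one_div, le_div_iff₀ (hq i)]
    linarith
  let u : Fin n → ℝ := (q ⬝ᵥ 1)⁻¹ • 1
  have hu : u ∈ posOrthant n := fun i => by simp [u, hq1]
  have huS : u ∈ S := ⟨posOrthant_subset_nonnegOrthant hu, by
    simp only [u, dotProduct_smul, smul_eq_mul, inv_mul_cancel₀ hq1.ne']⟩
  obtain ⟨x, ⟨hx, hqx⟩, hmax⟩ := hS.exists_isMaxOn ⟨u, huS⟩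
    (hf.continuousOn.mono fun y hy => hy.1)
  have hfx : 0 < f x := lt_of_lt_of_le (hf.pos u hu) (hmax huS)
  have hxp : x ∈ posOrthant n := by
    by_contra h
    rw [hbd x hx h] at hfx
    exact hfx.false
  refine ⟨x, hxp, ?_⟩
  have hle : ∀ y ∈ posOrthant n, f y ≤ (f x • q) ⬝ᵥ y := by
    intro y hy
    have hy0 : 0 < q ⬝ᵥ y := by
      rw [dotProduct_comm]
      refine dotProduct_pos_of_mem hy (posOrthant_subset_nonnegOrthant hq) fun h0 => ?_
      rw [h0, zero_dotProduct] at hq1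
      exact hq1.false
    have h2 := hmax (show (q ⬝ᵥ y)⁻¹ • y ∈ S from
      ⟨smul_mem_nonnegOrthant (inv_nonneg.2 hy0.le) (posOrthant_subset_nonnegOrthant hy), by
        rw [dotProduct_smul, smul_eq_mul, inv_mul_cancel₀ hy0.ne']⟩)
    simp only [mem_ofPred_eq, hf.isUtility.homogeneous _ (inv_nonneg.2 hy0.le) y
      (posOrthant_subset_nonnegOrthant hy), inv_mul_eq_div, div_le_iff₀ hy0] at h2
    rwa [smul_dotProduct, smul_eq_mul]
  have hgrad : ∀ v, fderiv ℝ f x v = (f x • q) ⬝ᵥ v := fun v =>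
    fderiv_apply_eq_dotProduct hxp (hf.differentiableAt hxp) hle
      (by rw [smul_dotProduct, hqx, smul_eq_mul, mul_one]) v
  ext i
  rw [logGradient, hgrad, smul_dotProduct, smul_eq_mul, mul_div_cancel_left₀ _ hfx.ne']
  simp

/-- Near each interior price vector the gauge transform is the reciprocal of `f` composed with a
local inverse of the logarithmic gradient. -/
theorem contDiffOn_gaugeTransform (hf : IsStrictSmoothGauge f)
    (hbd : ∀ x ∈ nonnegOrthant n, x ∉ posOrthant n → f x = 0) :
    ContDiffOn ℝ ∞ (gaugeTransform f) (posOrthant n) := by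
  intro q hq
  refine ContDiffAt.contDiffWithinAt ?_
  obtain ⟨x, hx, rfl⟩ := hf.exists_logGradient_eq hbd hq
  have hgrad : ∀ i, fderiv ℝ f x (Pi.single i 1) ≠ 0 := fun i h => by
    have h2 : 0 < logGradient f x i := hq i
    rw [logGradient, h, zero_div] at h2
    exact h2.false
  have hC := hf.contDiffAt_logGradient hx
  let A : (Fin n → ℝ) →L[ℝ] (Fin n → ℝ) := fderiv ℝ (logGradient f) x
  have hinj : Function.Injective (A : (Fin n → ℝ) →ₗ[ℝ] (Fin n → ℝ)) :=
    (injective_iff_map_eq_zero _).2 fun v hv =>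
      hf.eq_zero_of_fderiv_logGradient_eq_zero hx hgrad hv
  let e : (Fin n → ℝ) ≃L[ℝ] (Fin n → ℝ) :=
    (LinearEquiv.ofInjectiveEndo _ hinj).toContinuousLinearEquiv
  have hA : HasFDerivAt (logGradient f) (e : (Fin n → ℝ) →L[ℝ] (Fin n → ℝ)) x := by
    have : (e : (Fin n → ℝ) →L[ℝ] (Fin n → ℝ)) = A := by ext v; rfl
    rw [this]
    exact (hC.differentiableAt (by simp)).hasFDerivAt
  let φ := hC.toOpenPartialHomeomorph (logGradient f) hA (by simp)
  have hφ : logGradient f x ∈ φ.target :=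
    hC.image_mem_toOpenPartialHomeomorph_target hA (by simp)
  have hinv : φ.symm (logGradient f x) = x := hC.localInverse_apply_image hA (by simp)
  have hsmooth : ContDiffAt ℝ ∞ φ.symm (logGradient f x) := hC.to_localInverse hA (by simp)
  have hmem : ∀ᶠ q in 𝓝 (logGradient f x), φ.symm q ∈ posOrthant n := by
    refine hsmooth.continuousAt.eventually ?_
    rw [hinv]
    exact posOrthant_mem_nhds hx
  have heq : gaugeTransform f =ᶠ[𝓝 (logGradient f x)] fun q => (f (φ.symm q))⁻¹ := by
    filter_upwards [hmem, φ.open_target.mem_nhds hφ, posOrthant_mem_nhds hq] with q h1 h2 h3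
    have h4 : logGradient f (φ.symm q) = q := φ.right_inv h2
    have h5 := hf.gaugeTransform_logGradient h1 (hf.logGradient_nonneg h1)
    rwa [h4] at h5
  refine ContDiffAt.congr_of_eventuallyEq ?_ heq
  refine ContDiffAt.inv ?_ ?_
  · refine ContDiffAt.comp _ ?_ hsmooth
    rw [hinv]
    exact hf.contDiffAt hx
  · rw [hinv]
    exact (hf.pos x hx).ne'

theorem exists_gaugeTransform_pos (hf : IsStrictSmoothGauge f) :
    ∃ q ∈ nonnegOrthant n, 0 < gaugeTransform f q := by
  have h1 : (1 : Fin n → ℝ) ∈ posOrthant n := fun _ => one_pos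
  refine ⟨_, hf.logGradient_nonneg h1, ?_⟩
  rw [hf.gaugeTransform_logGradient h1 (hf.logGradient_nonneg h1)]
  exact inv_pos.2 (hf.pos _ h1)

/-- Biduality. In the interior the tangent hyperplane is a minimizer; a boundary point is
approached by the interior points that dominate it. -/
theorem gaugeTransform_gaugeTransform (hf : IsStrictSmoothGauge f)
    (hbd : ∀ x ∈ nonnegOrthant n, x ∉ posOrthant n → f x = 0) (hx : x ∈ nonnegOrthant n) :
    gaugeTransform (gaugeTransform f) x = f x := by
  obtain ⟨q₀, hq₀, hq₀'⟩ := hf.exists_gaugeTransform_pos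
  have hint : ∀ y ∈ posOrthant n, gaugeTransform (gaugeTransform f) y ≤ f y := by
    intro y hy
    have hq := hf.logGradient_nonneg hy
    have hG := hf.gaugeTransform_logGradient hy hq
    have hpos := hf.pos y hy
    have h := gaugeTransform_le (f := gaugeTransform f) (posOrthant_subset_nonnegOrthant hy) hq
      (by rw [hG]; exact inv_pos.2 hpos)
    rwa [hG, dotProduct_comm, dotProduct_logGradient, hf.fderiv_self hy, div_self hpos.ne',
      one_div, inv_inv] at h
  refine le_antisymm ?_ ?_
  · by_cases hxp : x ∈ posOrthant n
    · exact hint x hxp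
    · rw [hbd x hx hxp]
      have hU := isUtility_gaugeTransform hq₀ hq₀'
      have hmem : ∀ s : ℝ, 0 < s → x + s • 1 ∈ posOrthant n := fun s hs i => by
        simpa using add_pos_of_nonneg_of_pos (hx i) hs
      have ht : Tendsto (fun s : ℝ => f (x + s • 1)) (𝓝[>] 0) (𝓝 (f x)) := by
        refine (hf.continuousOn x hx).tendsto.comp (tendsto_nhdsWithin_iff.2
          ⟨(tendsto_line x 1).mono_left nhdsWithin_le_nhds, ?_⟩)
        filter_upwards [self_mem_nhdsWithin] with s hs
        exact posOrthant_subset_nonnegOrthant (hmem s hs)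
      rw [hbd x hx hxp] at ht
      refine ge_of_tendsto ht ?_
      filter_upwards [self_mem_nhdsWithin] with s hs
      refine le_trans (hU.mono hx fun i => ?_) (hint _ (hmem s hs))
      have hs0 : (0 : ℝ) < s := hs
      simpa using hs0.le
  · refine le_gaugeTransform hq₀ hq₀' fun q hq hGq => ?_
    rcases (hf.isUtility.nonneg x hx).eq_or_lt with h0 | h0
    · rw [← h0, zero_mul]
      exact dotProduct_nonneg_of_mem hq hx
    · have := mul_gaugeTransform_le hq hx h0
      rw [dotProduct_comm]
      linarith

/-- A strict smooth gauge that vanishes on the boundary and its transform are both smooth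
utilities. -/
theorem isSmoothUtility (hf : IsStrictSmoothGauge f)
    (hbd : ∀ x ∈ nonnegOrthant n, x ∉ posOrthant n → f x = 0) (k : ℕ) :
    IsSmoothUtility k f ∧ IsSmoothUtility k (gaugeTransform f) := by
  have h1 : (1 : Fin n → ℝ) ∈ posOrthant n := fun _ => one_pos
  have h1' := posOrthant_subset_nonnegOrthant h1
  obtain ⟨q₀, hq₀, hq₀'⟩ := hf.exists_gaugeTransform_pos
  have hk : (k : WithTop ℕ∞) ≤ ∞ := by exact_mod_cast le_top
  have hs : IsSmoothOnOrthant k f := ⟨hf.continuousOn, hf.contDiffOn.of_le hk⟩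
  have hs' : IsSmoothOnOrthant k (gaugeTransform f) :=
    ⟨continuousOn_gaugeTransform h1' (hf.pos _ h1), (hf.contDiffOn_gaugeTransform hbd).of_le hk⟩
  refine ⟨⟨hf.isUtility, ⟨1, h1', (hf.pos _ h1).ne'⟩, hs, hs'⟩,
    ⟨isUtility_gaugeTransform h1' (hf.pos _ h1), ⟨q₀, hq₀, hq₀'.ne'⟩, hs', ?_⟩⟩
  exact ⟨hs.1.congr fun x hx => hf.gaugeTransform_gaugeTransform hbd hx,
    hs.2.congr fun x hx => hf.gaugeTransform_gaugeTransform hbd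
      (posOrthant_subset_nonnegOrthant hx)⟩

end IsStrictSmoothGauge

/-! ### A smooth minimum of two numbers -/

/-- A concave smoothing of `r ↦ (1 - |r|) / 2` that agrees with it exactly outside of `(-δ, δ)` and
is strictly concave inside. -/
structure IsMinProfile (δ : ℝ) (h : ℝ → ℝ) : Prop where
  contDiff : ContDiff ℝ ∞ h
  deriv2_nonpos : ∀ r, deriv (deriv h) r ≤ 0
  deriv2_neg : ∀ r, |r| < δ → deriv (deriv h) r < 0
  eq_right : ∀ r, δ ≤ r → h r = (1 - r) / 2
  eq_left : ∀ r, r ≤ -δ → h r = (1 + r) / 2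

/-- Integrate a bump function supported in `[-δ, δ]` twice. -/
theorem exists_isMinProfile {δ : ℝ} (hδ : 0 < δ) : ∃ h, IsMinProfile δ h := by
  let ρ : ℝ → ℝ := fun u => expNegInvGlue (δ ^ 2 - u ^ 2)
  have hρ : ContDiff ℝ ∞ ρ := expNegInvGlue.contDiff.comp (by fun_prop)
  have hρ0 : ∀ u, 0 ≤ ρ u := fun u => expNegInvGlue.nonneg _
  have hρpos : ∀ u, |u| < δ → 0 < ρ u := fun u hu => expNegInvGlue.pos_of_pos <| by
    have := sq_lt_sq' (abs_lt.1 hu).1 (abs_lt.1 hu).2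
    linarith
  have hρout : ∀ u, δ ≤ u → ρ u = 0 := fun u hu => expNegInvGlue.zero_of_nonpos <| by nlinarith
  have hρeven : ∀ u, ρ (-u) = ρ u := fun u => by simp only [ρ, neg_sq]
  let I : ℝ → ℝ := fun r => ∫ u in (0 : ℝ)..r, ρ u
  have hI : ∀ r, HasDerivAt I (ρ r) r := fun r =>
    (hρ.continuous.integral_hasStrictDerivAt 0 r).hasDerivAt
  have hIpos : 0 < I δ := by
    refine intervalIntegral.intervalIntegral_pos_of_pos_on
      (hρ.continuous.intervalIntegrable _ _) (fun u hu => hρpos u ?_) hδ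
    rw [abs_of_pos hu.1]
    exact hu.2
  have hIout : ∀ r, δ ≤ r → I r = I δ := by
    intro r hr
    have h1 := intervalIntegral.integral_add_adjacent_intervals
      (hρ.continuous.intervalIntegrable (μ := MeasureTheory.volume) 0 δ)
      (hρ.continuous.intervalIntegrable δ r)
    have h2 : ∫ u in δ..r, ρ u = ∫ u in δ..r, (0 : ℝ) :=
      intervalIntegral.integral_congr fun u hu => by
        rw [uIcc_of_le hr] at hu
        exact hρout u hu.1
    rw [h2, intervalIntegral.integral_zero, add_zero] at h1
    exact h1.symm
  have hIodd : ∀ r, I (-r) = -I r := by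
    intro r
    have h1 := intervalIntegral.integral_comp_neg (a := 0) (b := r) ρ
    simp only [hρeven, neg_zero] at h1
    change _ = -∫ u in (0 : ℝ)..r, ρ u
    rw [h1, intervalIntegral.integral_symm 0 (-r), neg_neg]
  have hIC : ContDiff ℝ ∞ I := by
    refine contDiff_infty_iff_deriv.2 ⟨fun r => (hI r).differentiableAt, ?_⟩
    rwa [show deriv I = ρ from funext fun r => (hI r).deriv]
  let w : ℝ → ℝ := fun r => -(I r / I δ) / 2
  have hwC : ContDiff ℝ ∞ w := by fun_prop
  have hw : ∀ r, HasDerivAt w (-(ρ r / I δ) / 2) r := fun r =>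
    (((hI r).div_const _).neg).div_const _
  let h : ℝ → ℝ := fun r => (1 - δ) / 2 + ∫ u in δ..r, w u
  have hh : ∀ r, HasDerivAt h (w r) r := fun r =>
    (hwC.continuous.integral_hasStrictDerivAt δ r).hasDerivAt.const_add _
  have hderiv : deriv h = w := funext fun r => (hh r).deriv
  have hright : ∀ r, δ ≤ r → h r = (1 - r) / 2 := by
    intro r hr
    have h2 : ∫ u in δ..r, w u = ∫ u in δ..r, (-1 / 2 : ℝ) :=
      intervalIntegral.integral_congr fun u hu => by
        rw [uIcc_of_le hr] at hu
        simp only [w]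
        rw [hIout u hu.1, div_self hIpos.ne']
    simp only [h]
    rw [h2, intervalIntegral.integral_const, smul_eq_mul]
    ring
  have heven : ∀ r, h (-r) = h r := by
    have hd : ∀ r, HasDerivAt (fun r => h (-r) - h r) 0 r := fun r => by
      have h1 : HasDerivAt (fun r : ℝ => h (-r)) (w (-r) * -1) r :=
        (hh (-r)).comp r (hasDerivAt_neg r)
      have h2 := h1.sub (hh r)
      have h3 : w (-r) * -1 - w r = 0 := by simp only [w, hIodd]; ring
      rwa [h3] at h2
    intro r
    have h1 := is_const_of_deriv_eq_zero (fun r => (hd r).differentiableAt)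
      (fun r => (hd r).deriv) r 0
    simp only [neg_zero, sub_self] at h1
    linarith
  refine ⟨h, ?_, ?_, ?_, hright, ?_⟩
  · exact contDiff_infty_iff_deriv.2 ⟨fun r => (hh r).differentiableAt, by rwa [hderiv]⟩
  · intro r
    rw [hderiv, (hw r).deriv]
    have := div_nonneg (hρ0 r) hIpos.le
    linarith
  · intro r hr
    rw [hderiv, (hw r).deriv]
    have := div_pos (hρpos r hr) hIpos
    linarith
  · intro r hr
    rw [← heven, hright (-r) (by linarith)]
    ring

namespace IsMinProfile

variable {δ : ℝ} {h : ℝ → ℝ}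

theorem concaveOn (hh : IsMinProfile δ h) : ConcaveOn ℝ univ h := by
  have hd : Differentiable ℝ h := hh.contDiff.differentiable (by simp)
  have hd' : Differentiable ℝ (deriv h) :=
    (contDiff_infty_iff_deriv.1 hh.contDiff).2.differentiable (by simp)
  exact concaveOn_univ_of_deriv2_nonpos hd hd' fun r => hh.deriv2_nonpos r

theorem le_tangent (hh : IsMinProfile δ h) (r s : ℝ) : h s ≤ h r + deriv h r * (s - r) := by
  have hd : HasDerivAt h (deriv h r) r :=
    ((hh.contDiff.differentiable (by simp)) r).hasDerivAt
  rcases lt_trichotomy r s with hrs | rfl | hrs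
  · have := hh.concaveOn.slope_le_of_hasDerivAt (mem_univ r) (mem_univ s) hrs hd
    rw [slope_def_field, div_le_iff₀ (by linarith)] at this
    linarith
  · simp
  · have := hh.concaveOn.le_slope_of_hasDerivAt (mem_univ s) (mem_univ r) hrs hd
    rw [slope_def_field, le_div_iff₀ (by linarith)] at this
    linarith

theorem le_right (hh : IsMinProfile δ h) (r : ℝ) : h r ≤ (1 - r) / 2 := by
  rcases le_or_gt δ r with hr | hr
  · exact (hh.eq_right r hr).le
  · -- compare with the values at the affine part, at the midpoint `δ` of `r` and `2 * δ - r`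
    have := hh.concaveOn.2 (mem_univ r) (mem_univ (2 * δ - r)) (show (0 : ℝ) ≤ 1 / 2 by norm_num)
      (show (0 : ℝ) ≤ 1 / 2 by norm_num) (by norm_num)
    simp only [smul_eq_mul] at this
    rw [show 1 / 2 * r + 1 / 2 * (2 * δ - r) = δ by ring, hh.eq_right δ le_rfl,
      hh.eq_right (2 * δ - r) (by linarith)] at this
    linarith

theorem le_left (hh : IsMinProfile δ h) (r : ℝ) : h r ≤ (1 + r) / 2 := by
  rcases le_or_gt r (-δ) with hr | hr
  · exact (hh.eq_left r hr).le
  · have := hh.concaveOn.2 (mem_univ r) (mem_univ (-2 * δ - r)) (show (0 : ℝ) ≤ 1 / 2 by norm_num)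
      (show (0 : ℝ) ≤ 1 / 2 by norm_num) (by norm_num)
    simp only [smul_eq_mul] at this
    rw [show 1 / 2 * r + 1 / 2 * (-2 * δ - r) = -δ by ring, hh.eq_left (-δ) le_rfl,
      hh.eq_left (-2 * δ - r) (by linarith)] at this
    linarith

theorem eq_of_le_abs (hh : IsMinProfile δ h) {r : ℝ} (hr : δ ≤ |r|) : h r = (1 - |r|) / 2 := by
  rcases le_abs.1 hr with h1 | h1
  · rcases abs_cases r with ⟨h2, _⟩ | ⟨h2, h3⟩
    · rw [h2, hh.eq_right r h1]
    · rw [h2] at hr ⊢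
      rw [hh.eq_left r (by linarith)]; ring
  · rcases abs_cases r with ⟨h2, _⟩ | ⟨h2, h3⟩
    · rw [h2] at hr ⊢
      rw [hh.eq_right r hr]
    · rw [h2, hh.eq_left r (by linarith)]; ring

theorem ge_of_abs_lt (hh : IsMinProfile δ h) {r : ℝ} (hr : |r| < δ) : (1 - δ) / 2 ≤ h r := by
  have h1 := hh.concaveOn.min_le_of_mem_Icc (mem_univ (-δ)) (mem_univ δ)
    (z := r) ⟨(abs_lt.1 hr).1.le, (abs_lt.1 hr).2.le⟩
  rw [hh.eq_left _ le_rfl, hh.eq_right _ le_rfl, ← sub_eq_add_neg, min_self] at h1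
  exact h1

end IsMinProfile

/-- The positively homogeneous function with `smoothMin h x y = h (x - y)` on the line
`x + y = 1`; for `h r = (1 - |r|) / 2` it is the minimum of `x` and `y`. -/
noncomputable def smoothMin (h : ℝ → ℝ) (x y : ℝ) : ℝ := (x + y) * h ((x - y) / (x + y))

section SmoothMin

variable {δ : ℝ} {h : ℝ → ℝ} {x y x' y' : ℝ}

theorem smoothMin_le_left (hh : IsMinProfile δ h) (hx : 0 ≤ x) (hy : 0 ≤ y) :
    smoothMin h x y ≤ x := by
  rcases (add_nonneg hx hy).eq_or_lt with h0 | h0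
  · rw [smoothMin, ← h0, zero_mul]; exact hx
  · have h1 := mul_le_mul_of_nonneg_left (hh.le_left ((x - y) / (x + y))) h0.le
    have h2 : (x + y) * ((1 + (x - y) / (x + y)) / 2) = x := by field_simp; ring
    exact h1.trans h2.le

theorem smoothMin_le_right (hh : IsMinProfile δ h) (hx : 0 ≤ x) (hy : 0 ≤ y) :
    smoothMin h x y ≤ y := by
  rcases (add_nonneg hx hy).eq_or_lt with h0 | h0
  · rw [smoothMin, ← h0, zero_mul]; exact hy
  · have h1 := mul_le_mul_of_nonneg_left (hh.le_right ((x - y) / (x + y))) h0.le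
    have h2 : (x + y) * ((1 - (x - y) / (x + y)) / 2) = y := by field_simp; ring
    exact h1.trans h2.le

theorem add_mul_profile_eq_min (h0 : 0 < x + y) :
    (x + y) * ((1 - |(x - y) / (x + y)|) / 2) = min x y := by
  rw [abs_div, abs_of_pos h0, min_def]
  split_ifs with hxy
  · rw [abs_of_nonpos (by linarith)]; field_simp; ring
  · rw [abs_of_pos (by linarith)]; field_simp; ring

theorem smoothMin_eq_min (hh : IsMinProfile δ h) (h0 : 0 < x + y)
    (hxy : δ * (x + y) ≤ |x - y|) : smoothMin h x y = min x y := by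
  rw [smoothMin, hh.eq_of_le_abs, add_mul_profile_eq_min h0]
  rwa [abs_div, abs_of_pos h0, le_div_iff₀ h0]

theorem le_smoothMin (hh : IsMinProfile δ h) (hδ : 0 < δ) (h0 : 0 < x + y) :
    min x y - δ * (x + y) / 2 ≤ smoothMin h x y := by
  have h2 : (1 - |(x - y) / (x + y)|) / 2 - δ / 2 ≤ h ((x - y) / (x + y)) := by
    rcases le_or_gt δ |(x - y) / (x + y)| with h1 | h1
    · rw [hh.eq_of_le_abs h1]; linarith
    · have := hh.ge_of_abs_lt h1
      have := abs_nonneg ((x - y) / (x + y))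
      linarith
  have h3 := mul_le_mul_of_nonneg_left h2 h0.le
  rw [mul_sub, add_mul_profile_eq_min h0] at h3
  rw [smoothMin]
  linarith

theorem smoothMin_mul (c : ℝ) : smoothMin h (c * x) (c * y) = c * smoothMin h x y := by
  rcases eq_or_ne c 0 with rfl | hc
  · simp [smoothMin]
  · rw [smoothMin, smoothMin, ← mul_add, ← mul_sub, mul_div_mul_left _ _ hc, mul_assoc]

theorem abs_ratio_lt_one (hx : 0 < x) (hy : 0 < y) : |(x - y) / (x + y)| < 1 := by
  rw [abs_div, abs_of_pos (add_pos hx hy), div_lt_one (add_pos hx hy), abs_lt]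
  constructor <;> linarith

theorem smoothMin_pos (hh : IsMinProfile δ h) (hδ1 : δ < 1) (hx : 0 < x) (hy : 0 < y) :
    0 < smoothMin h x y := by
  refine mul_pos (add_pos hx hy) ?_
  have hr := abs_ratio_lt_one hx hy
  rcases le_or_gt δ |(x - y) / (x + y)| with h1 | h1
  · rw [hh.eq_of_le_abs h1]; linarith
  · have := hh.ge_of_abs_lt h1
    linarith

theorem smoothMin_nonneg (hh : IsMinProfile δ h) (hδ1 : δ < 1) (hx : 0 ≤ x) (hy : 0 ≤ y) :
    0 ≤ smoothMin h x y := by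
  rcases (add_nonneg hx hy).eq_or_lt with h0 | h0
  · rw [smoothMin, ← h0, zero_mul]
  · refine mul_nonneg h0.le ?_
    have hr : |(x - y) / (x + y)| ≤ 1 := by
      rw [abs_div, abs_of_pos h0, div_le_one h0, abs_le]
      constructor <;> linarith
    rcases le_or_gt δ |(x - y) / (x + y)| with h1 | h1
    · rw [hh.eq_of_le_abs h1]; linarith
    · have := hh.ge_of_abs_lt h1
      linarith

theorem smoothMin_add_le (hh : IsMinProfile δ h) (hx : 0 ≤ x) (hy : 0 ≤ y)
    (hx' : 0 ≤ x') (hy' : 0 ≤ y') :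
    smoothMin h x y + smoothMin h x' y' ≤ smoothMin h (x + x') (y + y') := by
  rcases (add_nonneg hx hy).eq_or_lt with h0 | h0
  · have h1 : x = 0 := by linarith
    have h2 : y = 0 := by linarith
    simp [h1, h2, smoothMin]
  rcases (add_nonneg hx' hy').eq_or_lt with h0' | h0'
  · have h1 : x' = 0 := by linarith
    have h2 : y' = 0 := by linarith
    simp [h1, h2, smoothMin]
  have hs : 0 < (x + y) + (x' + y') := by linarith
  have h1 := hh.concaveOn.2 (mem_univ ((x - y) / (x + y))) (mem_univ ((x' - y') / (x' + y')))
    (div_nonneg h0.le hs.le) (div_nonneg h0'.le hs.le) (by rw [← add_div, div_self hs.ne'])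
  have h2 : ((x + y) / ((x + y) + (x' + y'))) • ((x - y) / (x + y)) +
      ((x' + y') / ((x + y) + (x' + y'))) • ((x' - y') / (x' + y')) =
      (x + x' - (y + y')) / (x + x' + (y + y')) := by
    have : 0 < x + x' + (y + y') := by linarith
    simp only [smul_eq_mul]
    field_simp
    ring
  rw [h2] at h1
  have h3 := mul_le_mul_of_nonneg_left h1 hs.le
  have h4 : ∀ a b : ℝ, ((x + y) + (x' + y')) *
      (((x + y) / ((x + y) + (x' + y'))) • a + ((x' + y') / ((x + y) + (x' + y'))) • b) =
      (x + y) * a + (x' + y') * b := fun a b => by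
    simp only [smul_eq_mul]
    field_simp
  rw [h4] at h3
  simp only [smoothMin]
  rw [show x + x' + (y + y') = (x + y) + (x' + y') by ring] at h3 ⊢
  exact h3

theorem smoothMin_mono (hh : IsMinProfile δ h) (hδ1 : δ < 1) (hx : 0 ≤ x) (hy : 0 ≤ y)
    (hxx : x ≤ x') (hyy : y ≤ y') : smoothMin h x y ≤ smoothMin h x' y' := by
  have h1 := smoothMin_add_le hh hx hy (sub_nonneg.2 hxx) (sub_nonneg.2 hyy)
  have h2 := smoothMin_nonneg hh hδ1 (sub_nonneg.2 hxx) (sub_nonneg.2 hyy)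
  rw [add_sub_cancel, add_sub_cancel] at h1
  linarith

/-- The first partial derivative of `smoothMin h`, as a function of `r = (x - y) / (x + y)`. -/
noncomputable def smoothMinFst (h : ℝ → ℝ) (r : ℝ) : ℝ := h r + (1 - r) * deriv h r

/-- The second partial derivative of `smoothMin h`, as a function of `r = (x - y) / (x + y)`. -/
noncomputable def smoothMinSnd (h : ℝ → ℝ) (r : ℝ) : ℝ := h r - (1 + r) * deriv h r

theorem hasDerivAt_smoothMin (hh : ContDiff ℝ ∞ h) {X Y : ℝ → ℝ} {s X' Y' : ℝ}
    (hX : HasDerivAt X X' s) (hY : HasDerivAt Y Y' s) (h0 : 0 < X s + Y s) :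
    HasDerivAt (fun s => smoothMin h (X s) (Y s))
      (X' * smoothMinFst h ((X s - Y s) / (X s + Y s)) +
        Y' * smoothMinSnd h ((X s - Y s) / (X s + Y s))) s := by
  have h1 := (hX.fun_sub hY).fun_div (hX.fun_add hY) h0.ne'
  have h2 := ((hh.differentiable (by simp)) ((X s - Y s) / (X s + Y s))).hasDerivAt
  have h3 := (hX.fun_add hY).fun_mul (h2.comp s h1)
  refine h3.congr_deriv ?_
  simp only [Function.comp_apply, smoothMinFst, smoothMinSnd]
  field_simp
  ring

theorem deriv_deriv_smoothMin (hh : ContDiff ℝ ∞ h) {X Y : ℝ → ℝ}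
    (hX : ContDiffAt ℝ 2 X 0) (hY : ContDiffAt ℝ 2 Y 0) (h0 : 0 < X 0 + Y 0) :
    deriv (deriv fun s => smoothMin h (X s) (Y s)) 0 =
      deriv (deriv X) 0 * smoothMinFst h ((X 0 - Y 0) / (X 0 + Y 0)) +
        deriv (deriv Y) 0 * smoothMinSnd h ((X 0 - Y 0) / (X 0 + Y 0)) +
        (2 * (deriv X 0 * Y 0 - X 0 * deriv Y 0)) ^ 2 / (X 0 + Y 0) ^ 3 *
          deriv (deriv h) ((X 0 - Y 0) / (X 0 + Y 0)) := by
  obtain ⟨hX1, hX2⟩ := hX.hasDerivAt_deriv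
  obtain ⟨hY1, hY2⟩ := hY.hasDerivAt_deriv
  have hev : ∀ᶠ s in 𝓝 0, 0 < X s + Y s :=
    (hX.continuousAt.add hY.continuousAt).eventually (lt_mem_nhds h0)
  have heq : (deriv fun s => smoothMin h (X s) (Y s)) =ᶠ[𝓝 0] fun s =>
      deriv X s * smoothMinFst h ((X s - Y s) / (X s + Y s)) +
        deriv Y s * smoothMinSnd h ((X s - Y s) / (X s + Y s)) := by
    filter_upwards [hX1, hY1, hev] with s h1 h2 h3
    exact (hasDerivAt_smoothMin hh h1 h2 h3).deriv
  rw [heq.deriv_eq]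
  have hr := (hX1.self_of_nhds.fun_sub hY1.self_of_nhds).fun_div
    (hX1.self_of_nhds.fun_add hY1.self_of_nhds) h0.ne'
  have hd := ((hh.differentiable (by simp)) ((X 0 - Y 0) / (X 0 + Y 0))).hasDerivAt
  have hd2 := (((contDiff_infty_iff_deriv.1 hh).2.differentiable (by simp))
    ((X 0 - Y 0) / (X 0 + Y 0))).hasDerivAt
  have e1 := hd.comp 0 hr
  have e2 := hd2.comp 0 hr
  refine ((hX2.fun_mul (e1.fun_add ((hr.const_sub 1).fun_mul e2))).fun_add
    (hY2.fun_mul (e1.fun_sub ((hr.const_add 1).fun_mul e2)))).deriv.trans ?_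
  simp only [Function.comp_apply, smoothMinFst, smoothMinSnd]
  field_simp
  ring

theorem smoothMinFst_nonneg (hh : IsMinProfile δ h) (hδ1 : δ < 1) (r : ℝ) :
    0 ≤ smoothMinFst h r := by
  have h1 := hh.le_tangent r 1
  rw [hh.eq_right 1 hδ1.le] at h1
  rw [smoothMinFst]
  linarith

theorem smoothMinSnd_nonneg (hh : IsMinProfile δ h) (hδ1 : δ < 1) (r : ℝ) :
    0 ≤ smoothMinSnd h r := by
  have h1 := hh.le_tangent r (-1)
  rw [hh.eq_left (-1) (by linarith)] at h1
  rw [smoothMinSnd]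
  linarith

theorem smoothMinFst_eq_zero (hh : IsMinProfile δ h) {r : ℝ} (hr : δ ≤ r) :
    smoothMinFst h r = 0 := by
  have h1 : HasDerivWithinAt h (-1 / 2) (Ici r) r :=
    (((hasDerivAt_id r).const_sub 1).div_const 2).hasDerivWithinAt.congr
      (fun s hs => hh.eq_right s (hr.trans hs)) (hh.eq_right r hr)
  have h2 := ((hh.contDiff.differentiable (by simp)) r).hasDerivAt.hasDerivWithinAt (s := Ici r)
  rw [smoothMinFst, (uniqueDiffOn_Ici r r self_mem_Ici).eq_deriv _ h2 h1, hh.eq_right r hr]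
  ring

theorem smoothMinSnd_eq_zero (hh : IsMinProfile δ h) {r : ℝ} (hr : r ≤ -δ) :
    smoothMinSnd h r = 0 := by
  have h1 : HasDerivWithinAt h (1 / 2) (Iic r) r :=
    (((hasDerivAt_id r).const_add 1).div_const 2).hasDerivWithinAt.congr
      (fun s hs => hh.eq_left s (le_trans hs hr)) (hh.eq_left r hr)
  have h2 := ((hh.contDiff.differentiable (by simp)) r).hasDerivAt.hasDerivWithinAt (s := Iic r)
  rw [smoothMinSnd, (uniqueDiffOn_Iic r r self_mem_Iic).eq_deriv _ h2 h1, hh.eq_left r hr]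
  ring

end SmoothMin

/-- Strict smooth gauges are closed under smooth minima. If the second derivative of the smooth
minimum vanishes in a direction, this direction is radial on the active coordinates of each of
the two functions that is active; when both are, strict concavity of the profile forces the two
radial factors to agree. -/
theorem IsStrictSmoothGauge.smoothMin {n : ℕ} {f g : (Fin n → ℝ) → ℝ} {δ : ℝ} {h : ℝ → ℝ}
    (hf : IsStrictSmoothGauge f) (hg : IsStrictSmoothGauge g)
    (hh : IsMinProfile δ h) (hδ1 : δ < 1) :
    IsStrictSmoothGauge fun x => _root_.smoothMin h (f x) (g x) := by
  have hf0 := hf.isUtility.nonneg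
  have hg0 := hg.isUtility.nonneg
  have hsecond : ∀ x ∈ posOrthant n, ∀ v,
      secondDeriv (fun x => _root_.smoothMin h (f x) (g x)) x v =
        secondDeriv f x v * smoothMinFst h ((f x - g x) / (f x + g x)) +
        secondDeriv g x v * smoothMinSnd h ((f x - g x) / (f x + g x)) +
        (2 * (fderiv ℝ f x v * g x - f x * fderiv ℝ g x v)) ^ 2 / (f x + g x) ^ 3 *
          deriv (deriv h) ((f x - g x) / (f x + g x)) := by
    intro x hx v
    have h1 := deriv_deriv_smoothMin hh.contDiff (hf.contDiffAt_line hx (v := v))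
      (hg.contDiffAt_line hx (v := v)) (by simpa using add_pos (hf.pos x hx) (hg.pos x hx))
    rw [hf.deriv_line hx, hg.deriv_line hx] at h1
    simp only [zero_smul, add_zero] at h1
    exact h1
  have hterms : ∀ x ∈ posOrthant n, ∀ v,
      secondDeriv f x v * smoothMinFst h ((f x - g x) / (f x + g x)) ≤ 0 ∧
      secondDeriv g x v * smoothMinSnd h ((f x - g x) / (f x + g x)) ≤ 0 ∧
      (2 * (fderiv ℝ f x v * g x - f x * fderiv ℝ g x v)) ^ 2 / (f x + g x) ^ 3 *
          deriv (deriv h) ((f x - g x) / (f x + g x)) ≤ 0 := by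
    intro x hx v
    have := hf.pos x hx
    have := hg.pos x hx
    exact ⟨mul_nonpos_of_nonpos_of_nonneg (hf.secondDeriv_nonpos x hx v)
        (smoothMinFst_nonneg hh hδ1 _),
      mul_nonpos_of_nonpos_of_nonneg (hg.secondDeriv_nonpos x hx v)
        (smoothMinSnd_nonneg hh hδ1 _),
      mul_nonpos_of_nonneg_of_nonpos (by positivity) (hh.deriv2_nonpos _)⟩
  have hC : ContDiffOn ℝ ∞ (fun x => _root_.smoothMin h (f x) (g x)) (posOrthant n) := by
    have h1 := hf.contDiffOn
    have h2 := hg.contDiffOn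
    exact (h1.add h2).mul (hh.contDiff.comp_contDiffOn
      ((h1.sub h2).div (h1.add h2) fun x hx => (add_pos (hf.pos x hx) (hg.pos x hx)).ne'))
  have hfd : ∀ x ∈ posOrthant n, ∀ v,
      fderiv ℝ (fun x => _root_.smoothMin h (f x) (g x)) x v =
        fderiv ℝ f x v * smoothMinFst h ((f x - g x) / (f x + g x)) +
        fderiv ℝ g x v * smoothMinSnd h ((f x - g x) / (f x + g x)) := by
    intro x hx v
    have hd := (hC.contDiffAt (posOrthant_mem_nhds hx)).differentiableAt (by simp)
    have h4 := (hd.hasFDerivAt.hasLineDerivAt v)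
    have h5 := hasDerivAt_smoothMin hh.contDiff
      ((hf.differentiableAt hx).hasFDerivAt.hasLineDerivAt v)
      ((hg.differentiableAt hx).hasFDerivAt.hasLineDerivAt v)
      (by simpa using add_pos (hf.pos x hx) (hg.pos x hx))
    simp only [zero_smul, add_zero] at h5
    exact HasDerivAt.unique h4 h5
  refine ⟨isUtility_of_add_le ?_ ?_ ?_, ?_, ?_, ?_, ?_, ?_⟩
  · exact fun x hx => smoothMin_nonneg hh hδ1 (hf0 x hx) (hg0 x hx)
  · intro c hc x hx
    rw [hf.isUtility.homogeneous c hc x hx, hg.isUtility.homogeneous c hc x hx, smoothMin_mul]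
  · intro x hx y hy
    exact (smoothMin_add_le hh (hf0 x hx) (hg0 x hx) (hf0 y hy) (hg0 y hy)).trans
      (smoothMin_mono hh hδ1 (add_nonneg (hf0 x hx) (hf0 y hy)) (add_nonneg (hg0 x hx) (hg0 y hy))
        (hf.isUtility.add_le hx hy) (hg.isUtility.add_le hx hy))
  · intro x hx
    rcases (add_nonneg (hf0 x hx) (hg0 x hx)).eq_or_lt with h0 | h0
    · -- where both functions vanish, the smooth minimum is squeezed between `0` and `f`
      have hfx : f x = 0 := by linarith [hf0 x hx, hg0 x hx]
      have ht : Tendsto f (𝓝[nonnegOrthant n] x) (𝓝 0) := hfx ▸ hf.continuousOn x hx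
      refine ContinuousWithinAt.congr_of_eventuallyEq (f := fun x => _root_.smoothMin h (f x) (g x))
        ?_ EventuallyEq.rfl rfl
      have h0' : _root_.smoothMin h (f x) (g x) = 0 := by rw [_root_.smoothMin, ← h0, zero_mul]
      change Tendsto _ _ (𝓝 (_root_.smoothMin h (f x) (g x)))
      rw [h0']
      refine tendsto_of_tendsto_of_tendsto_of_le_of_le' tendsto_const_nhds ht ?_ ?_
      · filter_upwards [self_mem_nhdsWithin] with y hy
        exact smoothMin_nonneg hh hδ1 (hf0 y hy) (hg0 y hy)
      · filter_upwards [self_mem_nhdsWithin] with y hy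
        exact smoothMin_le_left hh (hf0 y hy) (hg0 y hy)
    · have h1 := hf.continuousOn x hx
      have h2 := hg.continuousOn x hx
      exact (h1.add h2).mul (hh.contDiff.continuous.continuousAt.comp_continuousWithinAt
        ((h1.sub h2).div (h1.add h2) h0.ne'))
  · exact hC
  · exact fun x hx => smoothMin_pos hh hδ1 (hf.pos x hx) (hg.pos x hx)
  · intro x hx v
    rw [hsecond x hx v]
    have := hterms x hx v
    linarith
  · intro x hx v h0
    rw [hsecond x hx v] at h0
    obtain ⟨t1, t2, t3⟩ := hterms x hx v
    have hfx := hf.pos x hx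
    have hgx := hg.pos x hx
    simp only [hfd x hx]
    set r := (f x - g x) / (f x + g x)
    have e1 : secondDeriv f x v * smoothMinFst h r = 0 := by linarith
    have e2 : secondDeriv g x v * smoothMinSnd h r = 0 := by linarith
    have e3 : (2 * (fderiv ℝ f x v * g x - f x * fderiv ℝ g x v)) ^ 2 / (f x + g x) ^ 3 *
        deriv (deriv h) r = 0 := by linarith
    by_cases m1 : smoothMinFst h r = 0
    · by_cases m2 : smoothMinSnd h r = 0
      · exact ⟨0, fun i hi => absurd (by rw [m1, m2]; ring) hi⟩
      · obtain ⟨c, hc⟩ := hg.radial_of_secondDeriv_eq_zero x hx v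
          ((mul_eq_zero.1 e2).resolve_right m2)
        refine ⟨c, fun i hi => hc i fun h0 => hi ?_⟩
        rw [h0, m1]; ring
    · obtain ⟨c, hc⟩ := hf.radial_of_secondDeriv_eq_zero x hx v
        ((mul_eq_zero.1 e1).resolve_right m1)
      by_cases m2 : smoothMinSnd h r = 0
      · refine ⟨c, fun i hi => hc i fun h0 => hi ?_⟩
        rw [h0, m2]; ring
      · obtain ⟨d, hd⟩ := hg.radial_of_secondDeriv_eq_zero x hx v
          ((mul_eq_zero.1 e2).resolve_right m2)
        have hr : |r| < δ := by
          refine abs_lt.2 ⟨?_, ?_⟩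
          · by_contra! hr
            exact m2 (smoothMinSnd_eq_zero hh hr)
          · by_contra! hr
            exact m1 (smoothMinFst_eq_zero hh hr)
        have e4 := (mul_eq_zero.1 e3).resolve_right (hh.deriv2_neg r hr).ne
        rw [div_eq_zero_iff, or_iff_left (by positivity), sq_eq_zero_iff,
          hf.fderiv_apply_of_radial hx hc, hg.fderiv_apply_of_radial hx hd] at e4
        have hcd : c = d := by
          have e5 : (c - d) * (f x * g x) = 0 := by linarith
          exact sub_eq_zero.1 ((mul_eq_zero.1 e5).resolve_right (by positivity))
        refine ⟨c, fun i hi => ?_⟩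
        by_contra hne
        have h1 : fderiv ℝ f x (Pi.single i 1) = 0 := by
          by_contra h1
          exact hne (hc i h1)
        have h2 : fderiv ℝ g x (Pi.single i 1) = 0 := by
          by_contra h2
          exact hne (hcd ▸ hd i h2)
        exact hi (by rw [h1, h2]; ring)

/-! ### Cobb–Douglas functions -/

/-- The weighted geometric mean with weights `α`. -/
noncomputable def cobbDouglas {n : ℕ} (α x : Fin n → ℝ) : ℝ := ∏ i, x i ^ α i

section CobbDouglas

variable {n : ℕ} {α b x y v : Fin n → ℝ} {c : ℝ}

theorem cobbDouglas_nonneg (hx : x ∈ nonnegOrthant n) : 0 ≤ cobbDouglas α x :=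
  Finset.prod_nonneg fun i _ => Real.rpow_nonneg (hx i) _

theorem cobbDouglas_pos (hx : x ∈ posOrthant n) : 0 < cobbDouglas α x :=
  Finset.prod_pos fun i _ => Real.rpow_pos_of_pos (hx i) _

theorem cobbDouglas_smul (hα1 : ∑ i, α i = 1) (hα : ∀ i, 0 ≤ α i) (hc : 0 ≤ c)
    (hx : x ∈ nonnegOrthant n) : cobbDouglas α (c • x) = c * cobbDouglas α x := by
  simp only [cobbDouglas, Pi.smul_apply, smul_eq_mul]
  rw [Finset.prod_congr rfl fun i _ => Real.mul_rpow hc (hx i), Finset.prod_mul_distrib,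
    ← Real.rpow_sum_of_nonneg hc fun i _ => hα i, hα1, Real.rpow_one]

/-- After division by the coordinates of the sum this is the inequality between the weighted
geometric and arithmetic means, for each of the two summands. -/
theorem cobbDouglas_add_le (hα : ∀ i, 0 ≤ α i) (hα1 : ∑ i, α i = 1)
    (hx : x ∈ nonnegOrthant n) (hy : y ∈ nonnegOrthant n) :
    cobbDouglas α x + cobbDouglas α y ≤ cobbDouglas α (x + y) := by
  have hs := add_mem_nonnegOrthant hx hy
  have key : ∀ z ∈ nonnegOrthant n, (∀ i, (x + y) i = 0 → z i = 0) →
      cobbDouglas α z ≤ (∑ i, α i * (z i / (x + y) i)) * cobbDouglas α (x + y) := by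
    intro z hz h0
    have h1 : cobbDouglas α z = (∏ i, (z i / (x + y) i) ^ α i) * cobbDouglas α (x + y) := by
      rw [cobbDouglas, cobbDouglas, ← Finset.prod_mul_distrib]
      refine Finset.prod_congr rfl fun i _ => ?_
      rw [← Real.mul_rpow (div_nonneg (hz i) (hs i)) (hs i), div_mul_cancel_of_imp (h0 i)]
    rw [h1]
    exact mul_le_mul_of_nonneg_right (Real.geom_mean_le_arith_mean_weighted _ _ _
      (fun i _ => hα i) hα1 fun i _ => div_nonneg (hz i) (hs i)) (cobbDouglas_nonneg hs)
  have h1 := key x hx fun i hi => by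
    have h2 : x i + y i = 0 := hi
    linarith [hx i, hy i]
  have h2 := key y hy fun i hi => by
    have h2 : x i + y i = 0 := hi
    linarith [hx i, hy i]
  have h3 : ∑ i, α i * (x i / (x + y) i) + ∑ i, α i * (y i / (x + y) i) ≤ 1 := by
    rw [← Finset.sum_add_distrib, ← hα1]
    refine Finset.sum_le_sum fun i _ => ?_
    rw [← mul_add, ← add_div]
    exact mul_le_of_le_one_right (hα i) (div_self_le_one _)
  have h4 := mul_le_mul_of_nonneg_right h3 (cobbDouglas_nonneg (α := α) hs)
  linarith

theorem continuous_cobbDouglas (hα : ∀ i, 0 ≤ α i) : Continuous (cobbDouglas α) :=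
  continuous_finsetProd _ fun i _ => (continuous_apply i).rpow_const fun _ => Or.inr (hα i)

theorem contDiffOn_cobbDouglas : ContDiffOn ℝ ∞ (cobbDouglas α) (posOrthant n) :=
  contDiffOn_prod fun i _ _ hx =>
    (contDiff_apply ℝ ℝ i).contDiffWithinAt.rpow_const_of_ne (hx i).ne'

theorem hasDerivAt_cobbDouglas_line (hx : x ∈ posOrthant n) :
    HasDerivAt (fun s : ℝ => cobbDouglas α (x + s • v))
      (cobbDouglas α x * ∑ i, α i * (v i / x i)) 0 := by
  have h1 : (fun s : ℝ => cobbDouglas α (x + s • v)) =ᶠ[𝓝 0]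
      fun s => Real.exp (∑ i, α i * Real.log (x i + s * v i)) := by
    filter_upwards [eventually_line_mem hx v] with s hs
    rw [Real.exp_sum, cobbDouglas]
    refine Finset.prod_congr rfl fun i _ => ?_
    rw [Real.rpow_def_of_pos (hs i), mul_comm]
    rfl
  refine HasDerivAt.congr_of_eventuallyEq ?_ h1
  have h2 : ∀ i, HasDerivAt (fun s : ℝ => α i * Real.log (x i + s * v i))
      (α i * (v i / x i)) 0 := fun i => by
    have h3 : HasDerivAt (fun s : ℝ => x i + s * v i) (v i) 0 := by
      simpa using ((hasDerivAt_id (0 : ℝ)).mul_const (v i)).const_add (x i)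
    have h4 := (h3.log (by simpa using (hx i).ne')).const_mul (α i)
    simpa using h4
  have h5 := (HasDerivAt.fun_sum (u := Finset.univ) fun i _ => h2 i).exp
  have h6 : Real.exp (∑ i, α i * Real.log (x i + 0 * v i)) = cobbDouglas α x := by
    rw [Real.exp_sum, cobbDouglas]
    refine Finset.prod_congr rfl fun i _ => ?_
    rw [Real.rpow_def_of_pos (hx i), mul_comm, zero_mul, add_zero]
  rwa [h6] at h5

theorem hasDerivAt_cobbDouglas_line_at {s : ℝ} (hs : x + s • v ∈ posOrthant n) :
    HasDerivAt (fun s : ℝ => cobbDouglas α (x + s • v))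
      (cobbDouglas α (x + s • v) * ∑ i, α i * (v i / (x + s • v) i)) s := by
  have h := hasDerivAt_cobbDouglas_line (α := α) (v := v) hs
  rw [← sub_self s] at h
  refine (h.comp_sub_const s s).congr_of_eventuallyEq (Eventually.of_forall fun u => ?_)
  simp only [sub_smul]
  congr 1
  abel

/-- The second logarithmic derivative of a Cobb–Douglas function is minus a weighted variance. -/
theorem deriv_deriv_cobbDouglas_line (hα1 : ∑ i, α i = 1) (hx : x ∈ posOrthant n) :
    deriv (deriv fun s : ℝ => cobbDouglas α (x + s • v)) 0 =
      -(cobbDouglas α x * ∑ i, α i * (v i / x i - ∑ j, α j * (v j / x j)) ^ 2) := by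
  have h1 : (deriv fun s : ℝ => cobbDouglas α (x + s • v)) =ᶠ[𝓝 0]
      fun s => cobbDouglas α (x + s • v) * ∑ i, α i * (v i / (x i + s * v i)) := by
    filter_upwards [eventually_line_mem hx v] with s hs
    exact (hasDerivAt_cobbDouglas_line_at hs).deriv
  have h2 : ∀ i, HasDerivAt (fun s : ℝ => α i * (v i / (x i + s * v i)))
      (-(α i * (v i / x i) ^ 2)) 0 := fun i => by
    have h3 : HasDerivAt (fun s : ℝ => x i + s * v i) (v i) 0 := by
      simpa using ((hasDerivAt_id (0 : ℝ)).mul_const (v i)).const_add (x i)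
    have h4 := (((hasDerivAt_const (0 : ℝ) (v i)).fun_div h3 (by simpa using (hx i).ne')).const_mul
      (α i))
    refine h4.congr_deriv ?_
    have := (hx i).ne'
    simp only [zero_mul, add_zero]
    field_simp
    ring
  have h5 := (hasDerivAt_cobbDouglas_line (α := α) (v := v) hx).fun_mul
    (HasDerivAt.fun_sum (u := Finset.univ) fun i _ => h2 i)
  rw [h1.deriv_eq, h5.deriv]
  simp only [zero_smul, zero_mul, add_zero]
  have h6 : ∀ m : ℝ, ∑ i, α i * (v i / x i - m) ^ 2 =
      ∑ i, α i * (v i / x i) ^ 2 - 2 * m * ∑ i, α i * (v i / x i) + m ^ 2 * ∑ i, α i := fun m => by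
    rw [Finset.mul_sum, Finset.mul_sum, ← Finset.sum_sub_distrib, ← Finset.sum_add_distrib]
    exact Finset.sum_congr rfl fun i _ => by ring
  rw [h6, hα1, Finset.sum_neg_distrib]
  ring

/-- A Cobb–Douglas function plus a linear function of the coordinates on which it depends. -/
theorem isStrictSmoothGauge_linear_add_cobbDouglas (hα : ∀ i, 0 ≤ α i) (hα1 : ∑ i, α i = 1)
    (hb : ∀ i, 0 ≤ b i) (hbα : ∀ i, α i = 0 → b i = 0) (hc : 0 < c) :
    IsStrictSmoothGauge fun x => b ⬝ᵥ x + c * cobbDouglas α x := by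
  have hC : ContDiffOn ℝ ∞ (fun x => b ⬝ᵥ x + c * cobbDouglas α x) (posOrthant n) := by
    refine ContDiffOn.add ?_ (contDiffOn_const.mul contDiffOn_cobbDouglas)
    unfold dotProduct
    exact (by fun_prop : ContDiff ℝ ∞ fun x : Fin n → ℝ => ∑ i, b i * x i).contDiffOn
  have hlin : ∀ x v : Fin n → ℝ, ∀ s : ℝ,
      HasDerivAt (fun s : ℝ => b ⬝ᵥ (x + s • v)) (b ⬝ᵥ v) s := fun x v s => by
    simp only [dotProduct_add, dotProduct_smul, smul_eq_mul]
    simpa using ((hasDerivAt_id s).mul_const (b ⬝ᵥ v)).const_add (b ⬝ᵥ x)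
  have hsecond : ∀ x ∈ posOrthant n, ∀ v,
      secondDeriv (fun x => b ⬝ᵥ x + c * cobbDouglas α x) x v =
        -(c * (cobbDouglas α x * ∑ i, α i * (v i / x i - ∑ j, α j * (v j / x j)) ^ 2)) := by
    intro x hx v
    have h1 : (deriv fun s : ℝ => b ⬝ᵥ (x + s • v) + c * cobbDouglas α (x + s • v)) =ᶠ[𝓝 0]
        fun s => b ⬝ᵥ v + c * deriv (fun s : ℝ => cobbDouglas α (x + s • v)) s := by
      filter_upwards [eventually_line_mem hx v] with s hs
      have h2 := hasDerivAt_cobbDouglas_line_at (α := α) hs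
      rw [h2.deriv]
      exact ((hlin x v s).fun_add (h2.const_mul c)).deriv
    rw [secondDeriv, h1.deriv_eq, deriv_const_add, deriv_const_mul_field,
      deriv_deriv_cobbDouglas_line hα1 hx]
    ring
  refine ⟨isUtility_of_add_le ?_ ?_ ?_, ?_, hC, ?_, ?_, ?_⟩
  · exact fun x hx => add_nonneg (dotProduct_nonneg_of_mem hb hx)
      (mul_nonneg hc.le (cobbDouglas_nonneg hx))
  · intro d hd x hx
    rw [cobbDouglas_smul hα1 hα hd hx, dotProduct_smul, smul_eq_mul]
    ring
  · intro x hx y hy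
    have := mul_le_mul_of_nonneg_left (cobbDouglas_add_le hα hα1 hx hy) hc.le
    rw [dotProduct_add]
    linarith
  · exact ((continuous_dotProduct_left b).add
      (continuous_const.mul (continuous_cobbDouglas hα))).continuousOn
  · exact fun x hx => add_pos_of_nonneg_of_pos
      (dotProduct_nonneg_of_mem hb (posOrthant_subset_nonnegOrthant hx))
      (mul_pos hc (cobbDouglas_pos hx))
  · intro x hx v
    rw [hsecond x hx v]
    have := cobbDouglas_pos (α := α) hx
    have h2 : 0 ≤ ∑ i, α i * (v i / x i - ∑ j, α j * (v j / x j)) ^ 2 :=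
      Finset.sum_nonneg fun i _ => mul_nonneg (hα i) (sq_nonneg _)
    rw [neg_nonpos]
    positivity
  · intro x hx v h0
    have hpos := cobbDouglas_pos (α := α) hx
    rw [hsecond x hx v, neg_eq_zero, mul_eq_zero, mul_eq_zero, or_iff_right hc.ne',
      or_iff_right hpos.ne', Finset.sum_eq_zero_iff_of_nonneg
        fun i _ => mul_nonneg (hα i) (sq_nonneg _)] at h0
    refine ⟨∑ j, α j * (v j / x j), fun i hi => ?_⟩
    have hαi : α i ≠ 0 := by
      intro h
      apply hi
      have h1 := hasDerivAt_line (f := fun x => b ⬝ᵥ x + c * cobbDouglas α x) (x := x)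
        (v := Pi.single i 1) (s := 0) (by
          simpa using (hC.contDiffAt (posOrthant_mem_nhds hx)).differentiableAt (by simp))
      simp only [zero_smul, add_zero] at h1
      rw [h1.unique ((hlin x _ 0).fun_add ((hasDerivAt_cobbDouglas_line hx).const_mul c)),
        dotProduct_single, mul_one, hbα i h, zero_add, Finset.sum_eq_zero, mul_zero, mul_zero]
      intro j _
      by_cases hj : j = i
      · rw [hj, h, zero_mul]
      · simp [hj]
    have h1 := h0 i (Finset.mem_univ i)
    rw [mul_eq_zero, or_iff_right hαi, sq_eq_zero_iff, sub_eq_zero] at h1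
    rw [← h1, div_mul_cancel₀ _ (hx i).ne']

end CobbDouglas

/-! ### Interpolation by a smooth gauge -/

section Interpolation

variable {n : ℕ}

/-- The Cobb–Douglas function with the budget shares of `(x, r)` as weights touches the linear
function `r` from below at `x`. A mixture of both is uniformly close to the linear function. -/
theorem exists_strictSmoothGauge_touching {x r : Fin n → ℝ} (hx : x ∈ posOrthant n)
    (hr : r ∈ nonnegOrthant n) (hr0 : r ≠ 0) {ε : ℝ} (hε : 0 < ε) (hε1 : ε < 1) :
    ∃ M : (Fin n → ℝ) → ℝ, IsStrictSmoothGauge M ∧ M x = r ⬝ᵥ x ∧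
      ∀ y ∈ nonnegOrthant n, (1 - ε) * (r ⬝ᵥ y) ≤ M y ∧ M y ≤ r ⬝ᵥ y := by
  have hrx : 0 < r ⬝ᵥ x := by
    rw [dotProduct_comm]; exact dotProduct_pos_of_mem hx hr hr0
  let α : Fin n → ℝ := fun i => r i * x i / (r ⬝ᵥ x)
  have hα : ∀ i, 0 ≤ α i := fun i => div_nonneg (mul_nonneg (hr i) (hx i).le) hrx.le
  have hα1 : ∑ i, α i = 1 := by
    rw [← Finset.sum_div]; exact div_self hrx.ne'
  have hCx : 0 < cobbDouglas α x := cobbDouglas_pos hx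
  have hle : ∀ y ∈ nonnegOrthant n, (r ⬝ᵥ x) / cobbDouglas α x * cobbDouglas α y ≤ r ⬝ᵥ y := by
    intro y hy
    have h1 := Real.geom_mean_le_arith_mean_weighted Finset.univ α (fun i => y i / x i)
      (fun i _ => hα i) hα1 fun i _ => div_nonneg (hy i) (hx i).le
    have h2 : ∏ i, (y i / x i) ^ α i = cobbDouglas α y / cobbDouglas α x := by
      rw [cobbDouglas, cobbDouglas, ← Finset.prod_div_distrib]
      exact Finset.prod_congr rfl fun i _ => Real.div_rpow (hy i) (hx i).le _
    have h3 : ∑ i, α i * (y i / x i) = (r ⬝ᵥ y) / (r ⬝ᵥ x) := by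
      rw [dotProduct, Finset.sum_div]
      refine Finset.sum_congr rfl fun i _ => ?_
      have := (hx i).ne'
      simp only [α]
      field_simp
    rw [h2, h3, le_div_iff₀ hrx] at h1
    calc (r ⬝ᵥ x) / cobbDouglas α x * cobbDouglas α y
        = cobbDouglas α y / cobbDouglas α x * (r ⬝ᵥ x) := by ring
      _ ≤ r ⬝ᵥ y := h1
  have hM := isStrictSmoothGauge_linear_add_cobbDouglas (b := (1 - ε) • r)
    (c := ε * ((r ⬝ᵥ x) / cobbDouglas α x)) hα hα1
    (smul_mem_nonnegOrthant (by linarith) hr) (fun i hi => by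
      have h1 : r i = 0 := by
        have h2 := (div_eq_zero_iff.1 hi).resolve_right hrx.ne'
        exact (mul_eq_zero.1 h2).resolve_right (hx i).ne'
      rw [Pi.smul_apply, h1, smul_zero]) (by positivity)
  refine ⟨_, hM, ?_, fun y hy => ?_⟩
  · simp only [smul_dotProduct, smul_eq_mul]
    field_simp
    ring
  · simp only [smul_dotProduct, smul_eq_mul, mul_assoc]
    have h1 := mul_le_mul_of_nonneg_left (hle y hy) hε.le
    have h2 : 0 ≤ (r ⬝ᵥ x) / cobbDouglas α x * cobbDouglas α y :=
      mul_nonneg (div_nonneg hrx.le hCx.le) (cobbDouglas_nonneg hy)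
    have h3 := mul_nonneg hε.le h2
    constructor <;> linarith

/-- If at each of finitely many interior points its own function is the strict minimum of a
family, the family has a smooth minimum that is exact at these points. -/
theorem exists_strictSmoothGauge_min {ι : Type*} [Finite ι]
    {M : ι → (Fin n → ℝ) → ℝ} {M₀ : (Fin n → ℝ) → ℝ} {x : ι → Fin n → ℝ}
    (hM : ∀ t, IsStrictSmoothGauge (M t)) (hM₀ : IsStrictSmoothGauge M₀)
    (hx : ∀ t, x t ∈ posOrthant n) (h₀ : ∀ t, M t (x t) < M₀ (x t))
    (h : ∀ t τ, t ≠ τ → M t (x t) < M τ (x t)) (s : Finset ι) :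
    ∃ P, IsStrictSmoothGauge P ∧ (∀ y ∈ nonnegOrthant n, P y ≤ M₀ y) ∧
      (∀ t ∈ s, ∀ y ∈ nonnegOrthant n, P y ≤ M t y) ∧
      (∀ t ∈ s, P (x t) = M t (x t)) ∧ ∀ t ∉ s, M t (x t) < P (x t) := by
  classical
  induction s using Finset.induction_on with
  | empty => exact ⟨M₀, hM₀, fun _ _ => le_rfl, by simp, by simp, fun t _ => h₀ t⟩
  | insert τ s hτ ih =>
    obtain ⟨P, hP, hP₀, hPle, hPeq, hPlt⟩ := ih
    have hPpos : ∀ t, 0 < P (x t) := fun t => hP.pos _ (hx t)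
    have hMpos : ∀ t u, 0 < M u (x t) := fun t u => (hM u).pos _ (hx t)
    have hsmall : ∀ A B : ℝ, 0 < B → ∀ᶠ δ : ℝ in 𝓝[>] 0, δ * A < B := fun A B hB => by
      have hc : Tendsto (fun δ : ℝ => δ * A) (𝓝 0) (𝓝 (0 * A)) :=
        (continuous_id.mul continuous_const).tendsto 0
      rw [zero_mul] at hc
      exact nhdsWithin_le_nhds (hc.eventually (gt_mem_nhds hB))
    have hne : ∀ t ∈ insert τ s, 0 < |P (x t) - M τ (x t)| := by
      intro t ht
      rw [abs_pos, sub_ne_zero]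
      rcases Finset.mem_insert.1 ht with rfl | hts
      · exact (hPlt _ hτ).ne'
      · rw [hPeq t hts]
        exact (h t τ fun he => hτ (he ▸ hts)).ne
    have hmin : ∀ t ∉ insert τ s, 0 < min (P (x t)) (M τ (x t)) - M t (x t) := by
      intro t ht
      rw [Finset.mem_insert, not_or] at ht
      exact sub_pos.2 (lt_min (hPlt t ht.2) (h t τ ht.1))
    have hev : ∀ᶠ δ : ℝ in 𝓝[>] 0, ∀ t,
        (t ∈ insert τ s → δ * (P (x t) + M τ (x t)) < |P (x t) - M τ (x t)|) ∧
        (t ∉ insert τ s →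
          δ * ((P (x t) + M τ (x t)) / 2) < min (P (x t)) (M τ (x t)) - M t (x t)) := by
      refine eventually_all.2 fun t => Eventually.and ?_ ?_
      · by_cases ht : t ∈ insert τ s
        · exact (hsmall _ _ (hne t ht)).mono fun _ h _ => h
        · exact Eventually.of_forall fun _ h => absurd h ht
      · by_cases ht : t ∈ insert τ s
        · exact Eventually.of_forall fun _ h => absurd ht h
        · exact (hsmall _ _ (hmin t ht)).mono fun _ h _ => h
    obtain ⟨δ, ⟨hδ, hδ1⟩, hδ0⟩ :=
      ((hev.and (hsmall 1 1 one_pos)).and self_mem_nhdsWithin).exists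
    have hδ0 : 0 < δ := hδ0
    rw [mul_one] at hδ1
    obtain ⟨m, hm⟩ := exists_isMinProfile hδ0
    have hPn := hP.isUtility.nonneg
    have hMn := (hM τ).isUtility.nonneg
    refine ⟨_, hP.smoothMin (hM τ) hm hδ1, fun y hy => ?_, fun t ht y hy => ?_,
      fun t ht => ?_, fun t ht => ?_⟩
    · exact (smoothMin_le_left hm (hPn y hy) (hMn y hy)).trans (hP₀ y hy)
    · rcases Finset.mem_insert.1 ht with rfl | hts
      · exact smoothMin_le_right hm (hPn y hy) (hMn y hy)
      · exact (smoothMin_le_left hm (hPn y hy) (hMn y hy)).trans (hPle t hts y hy)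
    · rw [smoothMin_eq_min hm (add_pos (hPpos t) (hMpos t τ)) ((hδ t).1 ht).le]
      rcases Finset.mem_insert.1 ht with rfl | hts
      · exact min_eq_right (hPlt _ hτ).le
      · rw [hPeq t hts]
        exact min_eq_left (h t τ fun he => hτ (he ▸ hts)).le
    · have h1 := (hδ t).2 ht
      have h2 := le_smoothMin hm hδ0 (add_pos (hPpos t) (hMpos t τ))
      linarith

/-- The smooth interpolation of the data. A large multiple of the symmetric Cobb–Douglas function
joins the family only to make the smooth minimum vanish on the boundary. -/
theorem exists_strictSmoothGauge_interpolating (hn : 1 ≤ n) {ι : Type*} [Finite ι]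
    {x r : ι → Fin n → ℝ} (hx : ∀ t, x t ∈ posOrthant n)
    (hr : ∀ t, r t ∈ nonnegOrthant n ∧ r t ≠ 0)
    (h : ∀ t τ, t ≠ τ → r t ⬝ᵥ x t < r τ ⬝ᵥ x t) :
    ∃ P, IsStrictSmoothGauge P ∧ (∀ y ∈ nonnegOrthant n, y ∉ posOrthant n → P y = 0) ∧
      (∀ t, P (x t) = r t ⬝ᵥ x t) ∧ ∀ t, ∀ y ∈ nonnegOrthant n, P y ≤ r t ⬝ᵥ y := by
  have := Fintype.ofFinite ι
  obtain ⟨ε, ⟨hε, hε1⟩, hε0⟩ : ∃ ε : ℝ, ((∀ t τ, t ≠ τ → r t ⬝ᵥ x t < (1 - ε) * (r τ ⬝ᵥ x t)) ∧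
      ε < 1) ∧ 0 < ε := by
    have hev : ∀ᶠ ε : ℝ in 𝓝[>] 0, ∀ t τ, t ≠ τ → r t ⬝ᵥ x t < (1 - ε) * (r τ ⬝ᵥ x t) := by
      refine eventually_all.2 fun t => eventually_all.2 fun τ => ?_
      by_cases hne : t = τ
      · exact Eventually.of_forall fun _ h => absurd hne h
      · have hc : Continuous fun ε : ℝ => (1 - ε) * (r τ ⬝ᵥ x t) := by fun_prop
        have := (hc.tendsto 0).eventually (lt_mem_nhds (a := r t ⬝ᵥ x t)
          (by simpa using h t τ hne))
        exact nhdsWithin_le_nhds (this.mono fun _ h _ => h)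
    exact ((hev.and (nhdsWithin_le_nhds (gt_mem_nhds one_pos))).and self_mem_nhdsWithin).exists
  choose M hM hMx hMb using fun t => exists_strictSmoothGauge_touching (hx t) (hr t).1 (hr t).2
    hε0 hε1
  let α : Fin n → ℝ := fun _ => (n : ℝ)⁻¹
  have hn0 : (n : ℝ) ≠ 0 := by exact_mod_cast (by omega : n ≠ 0)
  have hα : ∀ i, 0 ≤ α i := fun _ => by positivity
  have hα1 : ∑ i, α i = 1 := by simp [α, hn0]
  let C : ℝ := 1 + ∑ t, (r t ⬝ᵥ x t) / cobbDouglas α (x t)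
  have hterm : ∀ t, 0 ≤ (r t ⬝ᵥ x t) / cobbDouglas α (x t) := fun t =>
    div_nonneg (dotProduct_nonneg_of_mem (hr t).1 (posOrthant_subset_nonnegOrthant (hx t)))
      (cobbDouglas_pos (hx t)).le
  have hC : 0 < C := add_pos_of_pos_of_nonneg one_pos (Finset.sum_nonneg fun t _ => hterm t)
  have hM₀ : IsStrictSmoothGauge fun y => (0 : Fin n → ℝ) ⬝ᵥ y + C * cobbDouglas α y :=
    isStrictSmoothGauge_linear_add_cobbDouglas hα hα1 (fun _ => le_rfl) (fun _ _ => rfl) hC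
  simp only [zero_dotProduct, zero_add] at hM₀
  obtain ⟨P, hP, hP₀, hPle, hPeq, -⟩ := exists_strictSmoothGauge_min hM hM₀ hx
    (fun t => by
      rw [hMx, ← div_lt_iff₀ (cobbDouglas_pos (hx t))]
      have := Finset.single_le_sum (fun t _ => hterm t) (Finset.mem_univ t)
      exact lt_of_le_of_lt this (lt_one_add _))
    (fun t τ hne => by
      rw [hMx]
      exact (hε t τ hne).trans_le (hMb τ _ (posOrthant_subset_nonnegOrthant (hx t))).1)
    Finset.univ
  refine ⟨P, hP, fun y hy hyp => ?_, fun t => (hPeq t (Finset.mem_univ t)).trans (hMx t),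
    fun t y hy => (hPle t (Finset.mem_univ t) y hy).trans (hMb t y hy).2⟩
  refine le_antisymm ?_ (hP.isUtility.nonneg y hy)
  obtain ⟨i, hi⟩ : ∃ i, ¬ 0 < y i := by
    by_contra! hall
    exact hyp hall
  have hyi : y i = 0 := le_antisymm (not_lt.1 hi) (hy i)
  have h0 : cobbDouglas α y = 0 :=
    Finset.prod_eq_zero (Finset.mem_univ i) (by rw [hyi, Real.zero_rpow (inv_ne_zero hn0)])
  have h1 := hP₀ y hy
  rwa [h0, mul_zero] at h1

/-- For interior prices, the interpolating price gauge rationalizes the data with the roles of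
prices and quantities exchanged, and its gauge transform rationalizes the data themselves. -/
theorem exists_smooth_rationalizations (hn : 1 ≤ n) (k : ℕ) {T : ℕ} {p q : Fin T → Fin n → ℝ}
    (hp : ∀ t, p t ∈ posOrthant n) (hq : ∀ t, q t ∈ nonnegOrthant n ∧ q t ≠ 0)
    (h : ∃ μ : Fin T → ℝ, (∀ t, 0 < μ t) ∧
      ∀ t τ, t ≠ τ → μ t * (p t ⬝ᵥ q t) < μ τ * (p t ⬝ᵥ q τ)) :
    (∃ P : (Fin n → ℝ) → ℝ, IsSmoothUtility k P ∧ ∀ t, IsBudgetArgmax P (q t) (p t)) ∧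
      ∃ Q : (Fin n → ℝ) → ℝ, IsSmoothUtility k Q ∧ ∀ t, IsBudgetArgmax Q (p t) (q t) := by
  obtain ⟨μ, hμ, hμ'⟩ := h
  obtain ⟨P, hP, hP₀, hPeq, hPle⟩ := exists_strictSmoothGauge_interpolating hn (x := p)
    (r := fun t => μ t • q t) hp
    (fun t => ⟨smul_mem_nonnegOrthant (hμ t).le (hq t).1, smul_ne_zero (hμ t).ne' (hq t).2⟩)
    (fun t τ hne => by
      simpa only [smul_dotProduct, smul_eq_mul, dotProduct_comm (q _)] using hμ' t τ hne)
  simp only [smul_dotProduct, smul_eq_mul] at hPeq hPle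
  obtain ⟨hPk, hQk⟩ := hP.isSmoothUtility hP₀ k
  have hp' : ∀ t, p t ∈ nonnegOrthant n := fun t => posOrthant_subset_nonnegOrthant (hp t)
  refine ⟨⟨P, hPk, fun t => ⟨hp' t, fun y hy hle => ?_⟩⟩,
    ⟨gaugeTransform P, hQk, fun t => ⟨(hq t).1, fun y hy hle => ?_⟩⟩⟩
  · rw [hPeq]
    exact (hPle t y hy).trans (mul_le_mul_of_nonneg_left hle (hμ t).le)
  · -- the gauge transform equals `1 / μ t` at `q t` and is at most `(p t y) / (p t q t) / μ t`
    have hPp := hP.pos _ (hp t)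
    have h1 : (μ t)⁻¹ ≤ gaugeTransform P (q t) :=
      le_gaugeTransform (hp' t) hPp fun z hz _ => by
        rw [inv_mul_le_iff₀ (hμ t), dotProduct_comm]
        exact hPle t z hz
    refine le_trans ?_ h1
    refine (gaugeTransform_le hy (hp' t) hPp).trans ?_
    rw [div_le_iff₀ hPp, hPeq, inv_mul_cancel_left₀ (hμ t).ne', dotProduct_comm (q t)]
    exact hle

end Interpolation

end

theorem mainTheorem1 {n T k : ℕ} (hn : 1 ≤ n) (hk : 1 ≤ k)
    (p q : Fin T → Fin n → ℝ)
    (hp : ∀ t, p t ∈ nonnegOrthant n ∧ p t ≠ 0)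
    (hq : ∀ t, q t ∈ nonnegOrthant n ∧ q t ≠ 0)
    (hdistinct : ∀ t τ, t ≠ τ → ¬ (SameRay ℝ (p t) (p τ) ∧ SameRay ℝ (q t) (q τ)))
    (hpos :
      ((∀ t, p t ∈ posOrthant n) ∧
        ∀ t τ, t ≠ τ → SameRay ℝ (q t) (q τ) → q t ∈ posOrthant n) ∨
      ((∀ t, q t ∈ posOrthant n) ∧
        ∀ t τ, t ≠ τ → SameRay ℝ (p t) (p τ) → p t ∈ posOrthant n)) :
    List.TFAE [
      ∃ Q : (Fin n → ℝ) → ℝ, IsSmoothUtility k Q ∧ ∀ t, IsBudgetArgmax Q (p t) (q t),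
      StrictHomogeneousStrongAxiom p q,
      ∃ l : Fin T → ℝ, (∀ t, 0 < l t) ∧
        ∀ t τ, t ≠ τ → l t * (p t ⬝ᵥ q t) < l τ * (p τ ⬝ᵥ q t),
      ∃ P : (Fin n → ℝ) → ℝ, IsSmoothUtility k P ∧ ∀ t, IsBudgetArgmax P (q t) (p t),
      ∃ μ : Fin T → ℝ, (∀ t, 0 < μ t) ∧
        ∀ t τ, t ≠ τ → μ t * (p t ⬝ᵥ q t) < μ τ * (p t ⬝ᵥ q τ)] := by
  have hpq := dotProduct_pos_of_positivity hp hq (hpos.imp And.left And.left)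
  have hqp : ∀ t τ, 0 < q t ⬝ᵥ p τ := fun t τ => by rw [dotProduct_comm]; exact hpq τ t
  tfae_have 1 → 3 := exists_strict_multipliers_of_smooth_rationalization hk hp hq hdistinct hpos
  tfae_have 2 → 3 := StrictHomogeneousStrongAxiom.exists_multipliers hpq
  tfae_have 3 → 2 := fun ⟨_, hl, h⟩ => strictHomogeneousStrongAxiom_of_multipliers hpq hl h
  tfae_have 3 → 5 := exists_dual_multipliers hpq
  tfae_have 5 → 3 := fun h => by
    simp only [dotProduct_comm (p _)] at h ⊢
    exact exists_dual_multipliers hqp h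
  tfae_have 4 → 5 := fun h => by
    simp only [dotProduct_comm (p _)]
    exact exists_strict_multipliers_of_smooth_rationalization hk hq hp
      (fun t τ hne hs => hdistinct t τ hne hs.symm) hpos.symm h
  have key : (∃ μ : Fin T → ℝ, (∀ t, 0 < μ t) ∧
      ∀ t τ, t ≠ τ → μ t * (p t ⬝ᵥ q t) < μ τ * (p t ⬝ᵥ q τ)) →
      (∃ P : (Fin n → ℝ) → ℝ, IsSmoothUtility k P ∧ ∀ t, IsBudgetArgmax P (q t) (p t)) ∧
      ∃ Q : (Fin n → ℝ) → ℝ, IsSmoothUtility k Q ∧ ∀ t, IsBudgetArgmax Q (p t) (q t) := by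
    intro h
    rcases hpos with ⟨hpos, -⟩ | ⟨hpos, -⟩
    · exact exists_smooth_rationalizations hn k hpos hq h
    · refine (exists_smooth_rationalizations hn k hpos hp ?_).symm
      simp only [dotProduct_comm (p _)] at h
      exact exists_dual_multipliers hqp h
  tfae_have 5 → 4 := fun h => (key h).1
  tfae_have 5 → 1 := fun h => (key h).2
  tfae_finish
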